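/- For a finite connected graph $G$ let $r_G(u,v)$ be the effective resistance between $u$ and $v$ when every edge is a unit resistor, and let $K\!f(G)=\sum_{\{u,v\}\subseteq V(G)}r_G(u,v)$ be its Kirchhoff index. Let $n\ge 1$ and $k_1,\dots,k_n\ge 4$. A polygonal chain with polygon sizes $k_1,\dots,k_n$ is a 2-connected outerplane graph, with all vertices of degree $2$ or $3$, whose interior faces are polygons $H_1,\dots,H_n$, where $H_i$ has $k_i$ sides, $H_i$ and $H_{i+1}$ share an edge for $1\le i<n$, and there are no other adjacencies between the $H_i$. For integers $0\le w_i\le k_i-4$ let $P(w)$ be the polygonal chain obtained from the ladder with $n$ consecutive squares by adding, for each $i$, $w_i$ vertices to the top edge and $k_i-4-w_i$ vertices to the bottom edge of the $i$-th square, and let $HP_n=P(0,\dots,0)$ be the helicene chain. Theorem. Among all polygonal chains with polygon sizes $k_1,\dots,k_n$ (in this order), $HP_n$ is, up to isomorphism, the unique one with minimum Kirchhoff index: $HP_n$ is such a chain, and every such chain $G$ satisfies $K\!f(G)\ge K\!f(HP_n)$, with equality if and only if $G\cong HP_n$. -/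

import Mathlib

/-! ### Resistance distance and Kirchhoff index -/

open Classical in
/-- `φ` is an electric potential on the network obtained from `G` by replacing every edge with a
unit resistor, when a unit current enters the network at `u` and leaves it at `v`: by Ohm's and
Kirchhoff's laws the net current leaving a vertex `x` is `∑_{y ~ x} (φ x - φ y) = (L φ) x`, where
`L` is the Laplacian matrix of `G`. -/
def IsUnitFlowPotential {V : Type*} [Fintype V] (G : SimpleGraph V) (u v : V) (φ : V → ℝ) : Prop :=
  (G.lapMatrix ℝ).mulVec φ = Pi.single u 1 - Pi.single v 1

open Classical in
/-- The resistance distance `r_G(u, v)`: the potential difference `φ u - φ v` that drives a unit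
current from `u` to `v`. Such a potential exists when `G` is connected
(`exists_isUnitFlowPotential`), and the difference does not depend on its choice
(`resistanceDist_eq`). -/
noncomputable def resistanceDist {V : Type*} [Fintype V] (G : SimpleGraph V) (u v : V) : ℝ :=
  if h : ∃ φ : V → ℝ, IsUnitFlowPotential G u v φ then h.choose u - h.choose v else 0

/-- The Kirchhoff index: the sum of the resistance distances over all unordered pairs of vertices
(half the sum over ordered pairs; the diagonal contributes `0`). -/
noncomputable def kirchhoffIndex {V : Type*} [Fintype V] (G : SimpleGraph V) : ℝ :=
  (∑ u, ∑ v, resistanceDist G u v) / 2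

theorem exists_isUnitFlowPotential {V : Type*} [Fintype V] {G : SimpleGraph V}
    (hG : G.Connected) (u v : V) : ∃ φ : V → ℝ, IsUnitFlowPotential G u v φ := by
  classical
  have hne : Nonempty V := hG.nonempty
  have hsym : (G.lapMatrix ℝ).transpose = G.lapMatrix ℝ := G.isSymm_lapMatrix ℝ
  have hone : ∀ φ : V → ℝ, ∑ x, (G.lapMatrix ℝ).mulVec φ x = 0 := by
    intro φ
    have h1 : (fun _ : V => (1 : ℝ)) ⬝ᵥ (G.lapMatrix ℝ).mulVec φ = 0 := by
      rw [Matrix.dotProduct_mulVec, ← Matrix.mulVec_transpose, hsym,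
        SimpleGraph.lapMatrix_mulVec_const_eq_zero, zero_dotProduct]
    simpa [dotProduct] using h1
  -- The map `φ ↦ L φ + (∑ φ) 1` is injective, hence surjective.
  let f : (V → ℝ) →ₗ[ℝ] (V → ℝ) :=
    (G.lapMatrix ℝ).mulVecLin + LinearMap.pi (fun _ => ∑ x, LinearMap.proj x)
  have hf : ∀ φ x, f φ x = (G.lapMatrix ℝ).mulVec φ x + ∑ y, φ y := by
    intro φ x
    simp [f]
  have hsum : ∀ φ, ∑ x, f φ x = Fintype.card V * ∑ y, φ y := by
    intro φ
    simp [hf, Finset.sum_add_distrib, hone]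
  have hcard : (Fintype.card V : ℝ) ≠ 0 := by exact_mod_cast Fintype.card_ne_zero
  have hinj : Function.Injective f := by
    rw [injective_iff_map_eq_zero]
    intro φ hφ
    have h0 : ∑ y, φ y = 0 := by
      have h2 := hsum φ
      rw [hφ] at h2
      simpa [hcard] using h2.symm
    have hL : (G.lapMatrix ℝ).mulVec φ = 0 := by
      funext x
      have h3 := hf φ x
      rw [hφ, h0] at h3
      simpa using h3.symm
    rw [SimpleGraph.lapMatrix_mulVec_eq_zero_iff_forall_reachable] at hL
    funext x
    have hc : ∀ y, φ y = φ x := fun y => hL y x (hG.preconnected y x)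
    simpa [hc, hcard] using h0
  obtain ⟨φ, hφ⟩ := (LinearMap.injective_iff_surjective.mp hinj) (Pi.single u 1 - Pi.single v 1)
  have h0 : ∑ y, φ y = 0 := by
    have h2 := hsum φ
    rw [hφ] at h2
    simpa [hcard] using h2.symm
  refine ⟨φ, ?_⟩
  unfold IsUnitFlowPotential
  funext x
  have h3 := hf φ x
  rw [hφ, h0, add_zero] at h3
  convert h3.symm

theorem resistanceDist_eq {V : Type*} [Fintype V] {G : SimpleGraph V} {u v : V} {φ : V → ℝ}
    (hφ : IsUnitFlowPotential G u v φ) : resistanceDist G u v = φ u - φ v := by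
  classical
  have h : ∃ φ : V → ℝ, IsUnitFlowPotential G u v φ := ⟨φ, hφ⟩
  rw [resistanceDist, dif_pos h]
  obtain ⟨ψ, hψ, hψ'⟩ : ∃ ψ, ψ = h.choose ∧ IsUnitFlowPotential G u v ψ := ⟨_, rfl, h.choose_spec⟩
  rw [← hψ]
  unfold IsUnitFlowPotential at hφ hψ'
  have hsym : (G.lapMatrix ℝ).transpose = G.lapMatrix ℝ := G.isSymm_lapMatrix ℝ
  have key : φ ⬝ᵥ (G.lapMatrix ℝ).mulVec ψ = ψ ⬝ᵥ (G.lapMatrix ℝ).mulVec φ := by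
    rw [Matrix.dotProduct_mulVec, ← Matrix.mulVec_transpose, hsym, dotProduct_comm]
  have e1 : φ ⬝ᵥ (G.lapMatrix ℝ).mulVec ψ = φ u - φ v := by
    have h1 : (G.lapMatrix ℝ).mulVec ψ = Pi.single u 1 - Pi.single v 1 := by convert hψ'
    rw [h1]; simp [dotProduct_sub]
  have e2 : ψ ⬝ᵥ (G.lapMatrix ℝ).mulVec φ = ψ u - ψ v := by
    have h1 : (G.lapMatrix ℝ).mulVec φ = Pi.single u 1 - Pi.single v 1 := by convert hφ
    rw [h1]; simp [dotProduct_sub]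
  linarith

/-! ### Polygonal chains -/

/-- `G` is a polygonal chain of `n` polygons `H_0, …, H_{n-1}` of sizes `k 0, …, k (n-1)`.
The polygons (the interior faces of the 2-connected outerplane graph `G`) are induced cycles, given
by embeddings of the cycle graphs; they cover all vertices and all edges of `G`; consecutive
polygons meet exactly in the two ends of a common edge; and non-consecutive polygons are disjoint
(equivalently, all vertices have degree at most 3). -/
def IsPolygonalChain {n : ℕ} (k : Fin n → ℕ) {V : Type*} (G : SimpleGraph V) : Prop :=
  ∃ H : ∀ i : Fin n, SimpleGraph.cycleGraph (k i) ↪g G,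
    (∀ x : V, ∃ i, x ∈ Set.range (H i)) ∧
    (∀ x y : V, G.Adj x y → ∃ i, x ∈ Set.range (H i) ∧ y ∈ Set.range (H i)) ∧
    (∀ i j : Fin n, (i : ℕ) + 1 = j →
      ∃ t b : V, G.Adj t b ∧ Set.range (H i) ∩ Set.range (H j) = {t, b}) ∧
    (∀ i j : Fin n, (i : ℕ) + 1 < j → Disjoint (Set.range (H i)) (Set.range (H j)))

/-- Subdivide the `n` consecutive edges of a path by `a 0, …, a (n-1)` new vertices and number the
vertices of the resulting path `0, 1, 2, …` in order: `rungPos a j` is the number of the `j`-th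
original vertex, `0 ≤ j ≤ n`. -/
def rungPos {n : ℕ} (a : Fin n → ℕ) (j : ℕ) : ℕ :=
  ∑ i ∈ Finset.univ.filter (fun i : Fin n => (i : ℕ) < j), (a i + 1)

/-- The vertices of a ladder with `n` squares after adding `a i` vertices to the top edge and `b i`
vertices to the bottom edge of the `i`-th square: those of the top path and of the bottom path. -/
abbrev LadderVertex {n : ℕ} (a b : Fin n → ℕ) : Type :=
  Fin (rungPos a n + 1) ⊕ Fin (rungPos b n + 1)

/-- The ladder with `n` squares after adding `a i` vertices to the top edge and `b i` vertices to
the bottom edge of the `i`-th square: two paths joined by `n + 1` rungs. -/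
def subdividedLadder {n : ℕ} (a b : Fin n → ℕ) : SimpleGraph (LadderVertex a b) where
  Adj
    | .inl x, .inl y => (x : ℕ) + 1 = y ∨ (y : ℕ) + 1 = x
    | .inr x, .inr y => (x : ℕ) + 1 = y ∨ (y : ℕ) + 1 = x
    | .inl x, .inr y => ∃ j ≤ n, (x : ℕ) = rungPos a j ∧ (y : ℕ) = rungPos b j
    | .inr y, .inl x => ∃ j ≤ n, (x : ℕ) = rungPos a j ∧ (y : ℕ) = rungPos b j
  symm := ⟨by
    rintro (x | x) (y | y) h
    · exact Or.symm h
    · exact h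
    · exact h
    · exact Or.symm h⟩
  loopless := ⟨by
    rintro (x | x) h
    · rcases h with h | h <;> omega
    · rcases h with h | h <;> omega⟩

/-- The polygonal chain `P(w)` with polygons of sizes `k i`: `w i` of the `k i - 4` vertices added
to the `i`-th square go to its top edge, the others to its bottom edge. -/
abbrev polygonalChain {n : ℕ} (k w : Fin n → ℕ) :
    SimpleGraph (LadderVertex w (fun i => k i - 4 - w i)) :=
  subdividedLadder w (fun i => k i - 4 - w i)

/-- The helicene chain `P(0, …, 0)`: all vertices are added to the bottom edges. -/
abbrev helicene {n : ℕ} (k : Fin n → ℕ) :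
    SimpleGraph (LadderVertex (fun _ : Fin n => 0) (fun i => k i - 4 - 0)) :=
  polygonalChain k (fun _ => 0)

/-!
A chain is determined, up to isomorphism, by the numbers `a i` and `b i` of vertices of the `i`-th
polygon on the two sides between its two shared edges: parametrizing the polygons one after the
other so that each starts at the edge shared with the previous one, the coincidences among the
vertices of the polygons depend on these numbers only (`IsPolygonalChain.exists_isChainParam`,
`IsChainParam.nonempty_iso`). So every chain is a subdivided ladder, and the helicene is one.
Moreover all `a i` can be interchanged with the `b i` (`IsChainParam.flip`), and the values at the
first and last polygon are irrelevant (`IsChainParam.change_ends`).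

The subdivided ladder is a cycle of length `N`, its outer boundary, with the inner rungs as chords.
Let `G` be the Green function of the cycle and `φ j` the potential of a unit current along the
`j`-th chord. Adding the chords changes the Green function by `-∑ K i j φ i ⊗ φ j`, where
`K = (1 + R)⁻¹` and `R i j` is the drop of `φ i` along the chord `j`; hence
`Kf = const - N ∑ K i j ⟨φ i, φ j⟩` (`kirchhoffIndex_chordedCycle`). The arcs cut off by the inner
rungs are nested intervals whose lengths depend on the polygon sizes only, and therefore so does
`R`, which is a discrete Green function on an interval (`bridgeKernel`). The product `⟨φ i, φ j⟩` is
computed with the Green function of the squared Laplacian, a quartic polynomial of the distance. It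
equals a function of the two lengths minus a positive multiple of `(D i - D j) ^ 2`, where
`D i - D j` is twice the displacement of the centre of one interval relative to the other, that is,
up to sign the difference between the numbers of vertices added at the bottom and at the top between
the two rungs
(`chordPairing_cycleBigreen_nested`). By a maximum principle the entries of `K` off the diagonal
are nonpositive (`exists_inverse_one_add_bridgeKernel`). Thus

`Kf = C - ∑ c i j (D i - D j) ^ 2` with `c i j ≥ 0` for `i ≠ j`

and `C`, `c` depending on the polygon sizes only (`exists_kirchhoffIndex_subdividedLadder`). All the
squares are maximal for the helicene; and since the coefficient of the first and the last inner
rung is positive, equality forces all vertices added to inner polygons to be on the same side.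
-/

/-! ### Cycle graphs -/

/-- Adjacency in a cycle graph in terms of the numbers `0, …, k - 1` of its vertices. -/
theorem cycleGraph_adj_iff_val {k : ℕ} (hk : 3 ≤ k) (x y : Fin k) :
    (SimpleGraph.cycleGraph k).Adj x y ↔
      (x : ℕ) + 1 = y ∨ (y : ℕ) + 1 = x ∨ ((x : ℕ) = 0 ∧ (y : ℕ) + 1 = k) ∨
        ((y : ℕ) = 0 ∧ (x : ℕ) + 1 = k) := by
  obtain ⟨m, rfl⟩ : ∃ m, k = m + 2 := ⟨k - 2, by omega⟩
  have hx := x.isLt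
  have hy := y.isLt
  rw [SimpleGraph.cycleGraph_adj']
  rw [Fin.val_sub, Fin.val_sub]
  rcases lt_trichotomy (x : ℕ) y with h | h | h
  · rw [show m + 2 - (y : ℕ) + x = m + 2 - (y - x) by omega,
      show m + 2 - (x : ℕ) + y = (y - x) + (m + 2) by omega, Nat.add_mod_right,
      Nat.mod_eq_of_lt (by omega), Nat.mod_eq_of_lt (by omega)]
    omega
  · rw [show m + 2 - (y : ℕ) + x = m + 2 by omega, show m + 2 - (x : ℕ) + y = m + 2 by omega,
      Nat.mod_self]
    omega
  · rw [show m + 2 - (x : ℕ) + y = m + 2 - (x - y) by omega,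
      show m + 2 - (y : ℕ) + x = (x - y) + (m + 2) by omega, Nat.add_mod_right,
      Nat.mod_eq_of_lt (by omega), Nat.mod_eq_of_lt (by omega)]
    omega

/-- The rotation of the cycle graph by `d`. -/
def cycleRotate (k : ℕ) [NeZero k] (hk : 3 ≤ k) (d : Fin k) :
    SimpleGraph.cycleGraph k ≃g SimpleGraph.cycleGraph k where
  toEquiv := Equiv.addRight d
  map_rel_iff' := by
    intro x y
    obtain ⟨m, rfl⟩ : ∃ m, k = m + 2 := ⟨k - 2, by omega⟩
    simp [SimpleGraph.cycleGraph_adj]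

/-- The reflection `x ↦ d - x` of the cycle graph. -/
def cycleReflect (k : ℕ) [NeZero k] (hk : 3 ≤ k) (d : Fin k) :
    SimpleGraph.cycleGraph k ≃g SimpleGraph.cycleGraph k where
  toEquiv := Equiv.subLeft d
  map_rel_iff' := by
    intro x y
    obtain ⟨m, rfl⟩ : ∃ m, k = m + 2 := ⟨k - 2, by omega⟩
    simp [SimpleGraph.cycleGraph_adj, or_comm]

/-- The reflection `x ↦ k - 1 - x` of the cycle graph. -/
def cycleRev (k : ℕ) (hk : 3 ≤ k) :
    SimpleGraph.cycleGraph k ≃g SimpleGraph.cycleGraph k where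
  toEquiv := Fin.revPerm
  map_rel_iff' := by
    intro x y
    rw [cycleGraph_adj_iff_val hk, cycleGraph_adj_iff_val hk]
    simp only [Fin.revPerm_apply, Fin.val_rev]
    omega

/-- A cycle in a graph can be parametrized so that a given edge is its closing edge, in a given
direction. -/
theorem exists_cycle_param_of_adj {V : Type*} {G : SimpleGraph V} {k : ℕ} (hk : 3 ≤ k)
    (H : SimpleGraph.cycleGraph k ↪g G) {t b : V} (ht : t ∈ Set.range H) (hb : b ∈ Set.range H)
    (hadj : G.Adj t b) :
    ∃ e : SimpleGraph.cycleGraph k ↪g G, Set.range e = Set.range H ∧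
      e ⟨0, by omega⟩ = t ∧ e ⟨k - 1, by omega⟩ = b := by
  obtain ⟨x, rfl⟩ := ht
  obtain ⟨y, rfl⟩ := hb
  rw [H.map_adj_iff] at hadj
  obtain ⟨m, rfl⟩ : ∃ m, k = m + 2 := ⟨k - 2, by omega⟩
  have hrange : ∀ f : SimpleGraph.cycleGraph (m + 2) ≃g SimpleGraph.cycleGraph (m + 2),
      Set.range (H.comp f.toEmbedding) = Set.range H := by
    intro f
    ext v
    constructor
    · rintro ⟨z, rfl⟩
      exact ⟨f z, rfl⟩
    · rintro ⟨z, rfl⟩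
      exact ⟨f.symm z, by simp⟩
  have hlast : (⟨m + 2 - 1, by omega⟩ : Fin (m + 2)) = -1 := by
    apply Fin.ext
    simp [Fin.coe_neg_one]
  rw [SimpleGraph.cycleGraph_adj] at hadj
  rcases hadj with h | h
  · refine ⟨H.comp (cycleRotate (m + 2) hk x).toEmbedding, hrange _, ?_, ?_⟩
    · show H ((0 : Fin (m + 2)) + x) = H x
      rw [zero_add]
    · show H ((⟨m + 2 - 1, by omega⟩ : Fin (m + 2)) + x) = H y
      rw [hlast, ← h]
      congr 1
      abel
  · refine ⟨H.comp (cycleReflect (m + 2) hk x).toEmbedding, hrange _, ?_, ?_⟩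
    · show H (x - (0 : Fin (m + 2))) = H x
      rw [sub_zero]
    · show H (x - (⟨m + 2 - 1, by omega⟩ : Fin (m + 2))) = H y
      rw [hlast, ← h]
      congr 1
      abel

/-- A cycle in a graph with two disjoint edges can be parametrized so that the first one is its
closing edge, in a given direction; the second one then joins two consecutive numbers. -/
theorem exists_cycle_param_of_adj_of_adj {V : Type*} {G : SimpleGraph V} {k : ℕ} (hk : 3 ≤ k)
    (H : SimpleGraph.cycleGraph k ↪g G) {t b t' b' : V}
    (ht : t ∈ Set.range H) (hb : b ∈ Set.range H) (hadj : G.Adj t b)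
    (ht' : t' ∈ Set.range H) (hb' : b' ∈ Set.range H) (hadj' : G.Adj t' b')
    (h1 : t' ≠ t) (h2 : t' ≠ b) (h3 : b' ≠ t) (h4 : b' ≠ b) :
    ∃ (e : SimpleGraph.cycleGraph k ↪g G) (a : ℕ), Set.range e = Set.range H ∧ a + 4 ≤ k ∧
      e ⟨0, by omega⟩ = t ∧ e ⟨k - 1, by omega⟩ = b ∧
      ∀ x, e x = t' ∨ e x = b' ↔ (x : ℕ) = a + 1 ∨ (x : ℕ) = a + 2 := by
  obtain ⟨e, he, he0, he1⟩ := exists_cycle_param_of_adj hk H ht hb hadj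
  rw [← he] at ht' hb'
  obtain ⟨x, rfl⟩ := ht'
  obtain ⟨y, rfl⟩ := hb'
  subst he0 he1
  rw [e.map_adj_iff, cycleGraph_adj_iff_val hk] at hadj'
  simp only [ne_eq, e.injective.eq_iff, Fin.ext_iff] at h1 h2 h3 h4
  have hx := x.isLt
  have hy := y.isLt
  refine ⟨e, min (x : ℕ) y - 1, he, by omega, rfl, rfl, ?_⟩
  intro z
  simp only [e.injective.eq_iff, Fin.ext_iff]
  omega

/-! ### Parametrized chains -/

/-- A parametrization `e` of the polygons of a polygonal chain in which the edge shared by the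
`i`-th polygon and the next one joins the vertices `a i + 1` and `a i + 2` of the former, and the
vertices `0` and `k - 1` of the latter. Thus, going around the `i`-th polygon from the edge shared
with the previous one, there are `a i` vertices on one side and `k i - 4 - a i` on the other. -/
def IsChainParam {n : ℕ} (k a : Fin n → ℕ) {V : Type*} (G : SimpleGraph V)
    (e : ∀ i : Fin n, SimpleGraph.cycleGraph (k i) ↪g G) : Prop :=
  (∀ v : V, ∃ i, v ∈ Set.range (e i)) ∧
  (∀ v w : V, G.Adj v w → ∃ i, v ∈ Set.range (e i) ∧ w ∈ Set.range (e i)) ∧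
  (∀ i j : Fin n, (i : ℕ) + 1 = j → ∀ x y, e i x = e j y ↔
    ((x : ℕ) = a i + 1 ∧ (y : ℕ) = 0) ∨ ((x : ℕ) = a i + 2 ∧ (y : ℕ) + 1 = k j)) ∧
  (∀ i j : Fin n, (i : ℕ) + 1 < j → ∀ x y, e i x ≠ e j y)

theorem IsChainParam.isPolygonalChain {n : ℕ} {k a : Fin n → ℕ} {V : Type*} {G : SimpleGraph V}
    {e : ∀ i : Fin n, SimpleGraph.cycleGraph (k i) ↪g G} (ha : ∀ i, a i + 4 ≤ k i)
    (he : IsChainParam k a G e) : IsPolygonalChain k G := by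
  obtain ⟨h1, h2, h3, h4⟩ := he
  refine ⟨e, h1, h2, ?_, ?_⟩
  · intro i j hij
    have hi := ha i
    have hj := ha j
    refine ⟨e i ⟨a i + 1, by omega⟩, e i ⟨a i + 2, by omega⟩, ?_, ?_⟩
    · rw [(e i).map_adj_iff, cycleGraph_adj_iff_val (by omega)]
      simp
    · ext v
      simp only [Set.mem_inter_iff, Set.mem_range, Set.mem_insert_iff, Set.mem_singleton_iff]
      constructor
      · rintro ⟨⟨x, rfl⟩, y, hy⟩
        have := (h3 i j hij x y).1 hy.symm
        simp only [(e i).injective.eq_iff, Fin.ext_iff]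
        omega
      · rintro (rfl | rfl)
        · exact ⟨⟨_, rfl⟩, ⟨0, by omega⟩, ((h3 i j hij _ _).2 (by simp)).symm⟩
        · exact ⟨⟨_, rfl⟩, ⟨k j - 1, by omega⟩,
            ((h3 i j hij _ _).2 (Or.inr ⟨rfl, by simp only; omega⟩)).symm⟩
  · intro i j hij
    rw [Set.disjoint_left]
    rintro _ ⟨x, rfl⟩ ⟨y, hy⟩
    exact h4 i j hij x y hy.symm

/-- Which of the vertices of the parametrized polygons coincide depends on `k` and `a` only. -/
theorem IsChainParam.apply_eq_apply_iff {n : ℕ} {k a : Fin n → ℕ} {V W : Type*}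
    {G : SimpleGraph V} {G' : SimpleGraph W}
    {e : ∀ i : Fin n, SimpleGraph.cycleGraph (k i) ↪g G}
    {e' : ∀ i : Fin n, SimpleGraph.cycleGraph (k i) ↪g G'}
    (he : IsChainParam k a G e) (he' : IsChainParam k a G' e') (i j : Fin n)
    (x : Fin (k i)) (y : Fin (k j)) : e i x = e j y ↔ e' i x = e' j y := by
  obtain ⟨-, -, h3, h4⟩ := he
  obtain ⟨-, -, h3', h4'⟩ := he'
  have key : ∀ i j : Fin n, (i : ℕ) < j → ∀ x y, e i x = e j y ↔ e' i x = e' j y := by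
    intro i j hij x y
    rcases Nat.lt_or_ge (i + 1) j with h | h
    · exact iff_of_false (h4 i j h x y) (h4' i j h x y)
    · rw [h3 i j (by omega), h3' i j (by omega)]
  rcases lt_trichotomy (i : ℕ) j with h | h | h
  · exact key i j h x y
  · obtain rfl : i = j := Fin.ext h
    rw [(e i).injective.eq_iff, (e' i).injective.eq_iff]
  · rw [eq_comm, key j i h y x, eq_comm]

theorem IsChainParam.nonempty_iso {n : ℕ} {k a : Fin n → ℕ} {V W : Type*}
    {G : SimpleGraph V} {G' : SimpleGraph W}
    {e : ∀ i : Fin n, SimpleGraph.cycleGraph (k i) ↪g G}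
    {e' : ∀ i : Fin n, SimpleGraph.cycleGraph (k i) ↪g G'}
    (he : IsChainParam k a G e) (he' : IsChainParam k a G' e') : Nonempty (G ≃g G') := by
  have hiff := he.apply_eq_apply_iff he'
  obtain ⟨h1, h2, -, -⟩ := he
  obtain ⟨h1', h2', -, -⟩ := he'
  choose i x hx using h1
  choose i' x' hx' using h1'
  have hf : ∀ j y, e' (i (e j y)) (x (e j y)) = e' j y := fun j y => (hiff _ _ _ _).1 (hx _)
  have hg : ∀ j y, e (i' (e' j y)) (x' (e' j y)) = e j y := fun j y => (hiff _ _ _ _).2 (hx' _)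
  refine ⟨⟨⟨fun v => e' (i v) (x v), fun w => e (i' w) (x' w), ?_, ?_⟩, ?_⟩⟩
  · intro v
    simp only [hg, hx]
  · intro w
    simp only [hf, hx']
  · intro v w
    simp only [Equiv.coe_fn_mk]
    constructor
    · intro h
      obtain ⟨j, ⟨y, hy⟩, ⟨z, hz⟩⟩ := h2' _ _ h
      have hy' := (hiff _ _ _ _).2 hy
      have hz' := (hiff _ _ _ _).2 hz
      rw [hx] at hy' hz'
      rw [← hy, ← hz, (e' j).map_adj_iff] at h
      rwa [← hy', ← hz', (e j).map_adj_iff]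
    · intro h
      obtain ⟨j, ⟨y, rfl⟩, ⟨z, rfl⟩⟩ := h2 _ _ h
      rw [(e j).map_adj_iff] at h
      rwa [hf, hf, (e' j).map_adj_iff]

/-- Turning a chain upside down. -/
theorem IsChainParam.flip {n : ℕ} {k a : Fin n → ℕ} {V : Type*} {G : SimpleGraph V}
    {e : ∀ i : Fin n, SimpleGraph.cycleGraph (k i) ↪g G} (ha : ∀ i, a i + 4 ≤ k i)
    (he : IsChainParam k a G e) :
    ∃ e' : ∀ i : Fin n, SimpleGraph.cycleGraph (k i) ↪g G,
      IsChainParam k (fun i => k i - 4 - a i) G e' := by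
  have hk : ∀ i, 3 ≤ k i := fun i => by have := ha i; omega
  have hrange : ∀ i, Set.range ((e i).comp (cycleRev (k i) (hk i)).toEmbedding) =
      Set.range (e i) := by
    intro i
    ext v
    constructor
    · rintro ⟨z, rfl⟩
      exact ⟨cycleRev (k i) (hk i) z, rfl⟩
    · rintro ⟨z, rfl⟩
      exact ⟨(cycleRev (k i) (hk i)).symm z, by simp⟩
  obtain ⟨h1, h2, h3, h4⟩ := he
  refine ⟨fun i => (e i).comp (cycleRev (k i) (hk i)).toEmbedding, ?_, ?_, ?_, ?_⟩
  · simpa only [hrange] using h1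
  · simpa only [hrange] using h2
  · intro i j hij x y
    have hi := ha i
    have hj := ha j
    have hx := x.isLt
    have hy := y.isLt
    show e i x.rev = e j y.rev ↔ _
    rw [h3 i j hij, Fin.val_rev, Fin.val_rev]
    beta_reduce
    omega
  · intro i j hij x y
    exact h4 i j hij _ _

/-- The numbers `a i` matter for the inner polygons only: the first polygon can be rotated, and
the last one shares no further edge. -/
theorem IsChainParam.change_ends {n : ℕ} {k a a' : Fin n → ℕ} {V : Type*} {G : SimpleGraph V}
    {e : ∀ i : Fin n, SimpleGraph.cycleGraph (k i) ↪g G} (ha : ∀ i, a i + 4 ≤ k i)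
    (ha' : ∀ i, a' i + 4 ≤ k i)
    (he : IsChainParam k a G e) (haa : ∀ i : Fin n, 0 < (i : ℕ) → (i : ℕ) + 1 < n → a i = a' i) :
    ∃ e' : ∀ i : Fin n, SimpleGraph.cycleGraph (k i) ↪g G, IsChainParam k a' G e' := by
  have hk : ∀ i, 3 ≤ k i := fun i => by have := ha i; omega
  have : ∀ i, NeZero (k i) := fun i => ⟨by have := ha i; omega⟩
  -- The first polygon is rotated so that the edge at `a i + 1` moves to `a' i + 1`.
  let d : ∀ i, Fin (k i) := fun i => if (i : ℕ) = 0 then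
    (⟨a i + 1, by have := ha i; omega⟩ : Fin (k i)) - ⟨a' i + 1, by have := ha' i; omega⟩ else 0
  have hrange : ∀ i, Set.range ((e i).comp (cycleRotate (k i) (hk i) (d i)).toEmbedding) =
      Set.range (e i) := by
    intro i
    ext v
    constructor
    · rintro ⟨z, rfl⟩
      exact ⟨cycleRotate (k i) (hk i) (d i) z, rfl⟩
    · rintro ⟨z, rfl⟩
      exact ⟨(cycleRotate (k i) (hk i) (d i)).symm z, by simp⟩
  obtain ⟨h1, h2, h3, h4⟩ := he
  refine ⟨fun i => (e i).comp (cycleRotate (k i) (hk i) (d i)).toEmbedding, ?_, ?_, ?_, ?_⟩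
  · simpa only [hrange] using h1
  · simpa only [hrange] using h2
  · intro i j hij x y
    have hi := ha i
    have hi' := ha' i
    have hj := ha j
    have hdj : d j = 0 := if_neg (by omega)
    show e i (x + d i) = e j (y + d j) ↔ _
    rw [h3 i j hij, hdj, add_zero]
    have hsucc : ∀ (c : ℕ) (hc : c + 2 < k i),
        (⟨c + 2, hc⟩ : Fin (k i)) = ⟨c + 1, by omega⟩ + 1 := by
      intro c hc
      apply Fin.ext
      rw [Fin.val_add, Fin.val_one', Nat.mod_eq_of_lt (show 1 < k i by omega),
        Nat.mod_eq_of_lt (show c + 1 + 1 < k i by omega)]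
    by_cases h0 : (i : ℕ) = 0
    · have hdi : d i = (⟨a i + 1, by omega⟩ : Fin (k i)) - ⟨a' i + 1, by omega⟩ := if_pos h0
      have e1 : ((x + d i : Fin (k i)) : ℕ) = a i + 1 ↔ (x : ℕ) = a' i + 1 := by
        have : x + d i = ⟨a i + 1, by omega⟩ ↔ x = ⟨a' i + 1, by omega⟩ := by
          rw [hdi, add_sub, sub_eq_iff_eq_add, add_comm, add_right_inj]
        simpa only [Fin.ext_iff] using this
      have e2 : ((x + d i : Fin (k i)) : ℕ) = a i + 2 ↔ (x : ℕ) = a' i + 2 := by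
        have : x + d i = ⟨a i + 2, by omega⟩ ↔ x = ⟨a' i + 2, by omega⟩ := by
          rw [hdi, hsucc, hsucc, add_sub, sub_eq_iff_eq_add, add_right_comm, add_right_comm,
            add_comm, add_assoc, add_right_inj, add_comm 1]
        simpa only [Fin.ext_iff] using this
      rw [e1, e2]
    · have hdi : d i = 0 := if_neg h0
      rw [hdi, add_zero, haa i (by omega) (by omega)]
  · intro i j hij x y
    exact h4 i j hij _ _

/-! ### Every polygonal chain has a parametrization -/

/-- `e` parametrizes the same polygon as `H i`, and the edge shared with the next polygon joins
the vertices `a + 1` and `a + 2`. -/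
def IsPolygonParam {n : ℕ} {k : Fin n → ℕ} {V : Type*} {G : SimpleGraph V}
    (H : ∀ i : Fin n, SimpleGraph.cycleGraph (k i) ↪g G) (i : Fin n)
    (p : (SimpleGraph.cycleGraph (k i) ↪g G) × ℕ) : Prop :=
  Set.range p.1 = Set.range (H i) ∧ p.2 + 4 ≤ k i ∧
    ∀ j : Fin n, (i : ℕ) + 1 = j →
      ∀ x, p.1 x ∈ Set.range (H j) ↔ (x : ℕ) = p.2 + 1 ∨ (x : ℕ) = p.2 + 2

theorem exists_isPolygonParam {n : ℕ} {k : Fin n → ℕ} (hk : ∀ i, 4 ≤ k i) {V : Type*}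
    {G : SimpleGraph V} {H : ∀ i : Fin n, SimpleGraph.cycleGraph (k i) ↪g G}
    (h3 : ∀ i j : Fin n, (i : ℕ) + 1 = j →
      ∃ t b : V, G.Adj t b ∧ Set.range (H i) ∩ Set.range (H j) = {t, b})
    (i : Fin n) {t b : V} (ht : t ∈ Set.range (H i)) (hb : b ∈ Set.range (H i)) (hadj : G.Adj t b)
    (hd : ∀ j : Fin n, (i : ℕ) + 1 = j → t ∉ Set.range (H j) ∧ b ∉ Set.range (H j)) :
    ∃ p, IsPolygonParam H i p ∧ p.1 ⟨0, by have := hk i; omega⟩ = t ∧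
      p.1 ⟨k i - 1, by have := hk i; omega⟩ = b := by
  have hki := hk i
  by_cases hi : (i : ℕ) + 1 < n
  · obtain ⟨t', b', hadj', hint⟩ := h3 i ⟨i + 1, hi⟩ rfl
    obtain ⟨hdt, hdb⟩ := hd ⟨i + 1, hi⟩ rfl
    have hmem : ∀ v, v = t' ∨ v = b' ↔ v ∈ Set.range (H i) ∧ v ∈ Set.range (H ⟨i + 1, hi⟩) := by
      intro v
      rw [← Set.mem_inter_iff, hint]
      simp
    have ht' := (hmem t').1 (Or.inl rfl)
    have hb' := (hmem b').1 (Or.inr rfl)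
    obtain ⟨e, a, he, ha, he0, he1, hea⟩ := exists_cycle_param_of_adj_of_adj (by omega) (H i)
      ht hb hadj ht'.1 hb'.1 hadj'
      (fun h => hdt (h ▸ ht'.2)) (fun h => hdb (h ▸ ht'.2))
      (fun h => hdt (h ▸ hb'.2)) (fun h => hdb (h ▸ hb'.2))
    refine ⟨(e, a), ⟨he, ha, ?_⟩, he0, he1⟩
    intro j hj x
    obtain rfl : j = ⟨i + 1, hi⟩ := Fin.ext hj.symm
    rw [← hea, hmem, ← he]
    simp
  · obtain ⟨e, he, he0, he1⟩ := exists_cycle_param_of_adj (by omega) (H i) ht hb hadj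
    refine ⟨(e, 0), ⟨he, by simpa using hki, ?_⟩, he0, he1⟩
    intro j hj
    have := j.isLt
    omega

theorem IsPolygonalChain.exists_isChainParam {n : ℕ} {k : Fin n → ℕ} (hk : ∀ i, 4 ≤ k i)
    {V : Type*} {G : SimpleGraph V} (hG : IsPolygonalChain k G) :
    ∃ (a : Fin n → ℕ) (e : ∀ i : Fin n, SimpleGraph.cycleGraph (k i) ↪g G),
      (∀ i, a i + 4 ≤ k i) ∧ IsChainParam k a G e := by
  obtain ⟨H, h1, h2, h3, h4⟩ := hG
  cases n with
  | zero =>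
    exact ⟨fun _ => 0, H, fun i => i.elim0, h1, h2, fun i => i.elim0, fun i => i.elim0⟩
  | succ m =>
  -- The first polygon: any edge disjoint from the one shared with the second polygon will do.
  have hbase : ∃ p, IsPolygonParam H 0 p := by
    have hk0 := hk 0
    by_cases hm : 1 < m + 1
    · obtain ⟨t', b', hadj', hint⟩ := h3 0 ⟨1, hm⟩ rfl
      have hmem : ∀ v, v = t' ∨ v = b' ↔ v ∈ Set.range (H 0) ∧ v ∈ Set.range (H ⟨1, hm⟩) := by
        intro v
        rw [← Set.mem_inter_iff, hint]
        simp
      have ht' := (hmem t').1 (Or.inl rfl)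
      have hb' := (hmem b').1 (Or.inr rfl)
      obtain ⟨e, he, he0, he1⟩ := exists_cycle_param_of_adj (by omega) (H 0) ht'.1 hb'.1 hadj'
      have hnot : ∀ x : Fin (k 0), (x : ℕ) ≠ 0 → (x : ℕ) ≠ k 0 - 1 →
          e x ∉ Set.range (H ⟨1, hm⟩) := by
        intro x hx0 hx1 hx
        have := (hmem (e x)).2 ⟨he ▸ Set.mem_range_self x, hx⟩
        rw [← he0, ← he1, e.injective.eq_iff, e.injective.eq_iff, Fin.ext_iff, Fin.ext_iff] at this
        exact this.elim hx0 hx1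
      obtain ⟨p, hp, -, -⟩ := exists_isPolygonParam hk h3 0
        (t := e ⟨1, by omega⟩) (b := e ⟨2, by omega⟩) (he ▸ Set.mem_range_self _)
        (he ▸ Set.mem_range_self _)
        (by rw [e.map_adj_iff, cycleGraph_adj_iff_val (by omega)]; simp) (by
          intro j hj
          obtain rfl : j = ⟨1, hm⟩ := Fin.ext (by rw [← hj]; rfl)
          exact ⟨hnot _ (by simp) (by simp only; omega), hnot _ (by simp) (by simp only; omega)⟩)
      exact ⟨p, hp⟩
    · obtain ⟨p, hp, -, -⟩ := exists_isPolygonParam hk h3 0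
        (t := H 0 ⟨0, by omega⟩) (b := H 0 ⟨1, by omega⟩) (Set.mem_range_self _)
        (Set.mem_range_self _)
        (by rw [(H 0).map_adj_iff, cycleGraph_adj_iff_val (by omega)]; simp) (by
          intro j hj
          have := j.isLt
          have h0 : ((0 : Fin (m + 1)) : ℕ) = 0 := rfl
          omega)
      exact ⟨p, hp⟩
  -- Each further polygon is parametrized starting from the edge shared with the previous one.
  have hstep : ∀ (i : Fin m) (p : {p // IsPolygonParam H i.castSucc p}),
      ∃ q : {q // IsPolygonParam H i.succ q},
        ∀ x y, p.1.1 x = q.1.1 y ↔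
          ((x : ℕ) = p.1.2 + 1 ∧ (y : ℕ) = 0) ∨ ((x : ℕ) = p.1.2 + 2 ∧ (y : ℕ) + 1 = k i.succ) := by
    rintro i ⟨⟨e, a⟩, hp1, hp2, hp3⟩
    simp only at hp1 hp2 hp3 ⊢
    have hij : ((i.castSucc : Fin (m + 1)) : ℕ) + 1 = i.succ := by simp
    have hk' := hk i.succ
    have ht := (hp3 i.succ hij ⟨a + 1, by omega⟩).2 (Or.inl rfl)
    have hb := (hp3 i.succ hij ⟨a + 2, by omega⟩).2 (Or.inr rfl)
    have hnot : ∀ x (j : Fin (m + 1)), ((i.succ : Fin (m + 1)) : ℕ) + 1 = j →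
        e x ∉ Set.range (H j) := by
      intro x j hj
      have hd := h4 i.castSucc j (by omega)
      rw [Set.disjoint_left] at hd
      exact hd (hp1 ▸ Set.mem_range_self x)
    obtain ⟨q, hq, hq0, hq1⟩ := exists_isPolygonParam hk h3 i.succ ht hb
      (by rw [e.map_adj_iff, cycleGraph_adj_iff_val (by omega)]; simp)
      (fun j hj => ⟨hnot _ j hj, hnot _ j hj⟩)
    refine ⟨⟨q, hq⟩, ?_⟩
    have hlt1 : a + 1 < k i.castSucc := by omega
    have hlt2 : a + 2 < k i.castSucc := by omega
    intro x y
    constructor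
    · intro hxy
      have hx := (hp3 i.succ hij x).1 (by rw [hxy, ← hq.1]; exact Set.mem_range_self y)
      rcases hx with hx | hx
      · left
        obtain rfl : x = ⟨a + 1, hlt1⟩ := Fin.ext hx
        rw [← hq0, q.1.injective.eq_iff] at hxy
        exact ⟨rfl, by rw [← hxy]⟩
      · right
        obtain rfl : x = ⟨a + 2, hlt2⟩ := Fin.ext hx
        rw [← hq1, q.1.injective.eq_iff] at hxy
        exact ⟨rfl, by rw [← hxy]; simp only; omega⟩
    · rintro (⟨hx, hy⟩ | ⟨hx, hy⟩)
      · obtain rfl : x = ⟨a + 1, hlt1⟩ := Fin.ext hx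
        rw [← hq0]
        congr 1
        exact Fin.ext hy.symm
      · obtain rfl : x = ⟨a + 2, hlt2⟩ := Fin.ext hx
        rw [← hq1]
        congr 1
        exact Fin.ext (by simp only; omega)
  obtain ⟨p0, hp0⟩ := hbase
  choose next hnext using hstep
  let f : ∀ i : Fin (m + 1), {p // IsPolygonParam H i p} := fun i =>
    Fin.induction (motive := fun i => {p // IsPolygonParam H i p}) ⟨p0, hp0⟩ next i
  have hf : ∀ i : Fin m, f i.succ = next i (f i.castSucc) := fun i => Fin.induction_succ ..
  have hrange : ∀ i, Set.range (f i).1.1 = Set.range (H i) := fun i => (f i).2.1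
  refine ⟨fun i => (f i).1.2, fun i => (f i).1.1, fun i => (f i).2.2.1, ?_, ?_, ?_, ?_⟩
  · simpa only [hrange] using h1
  · simpa only [hrange] using h2
  · intro i j hij x y
    have hj := j.isLt
    obtain ⟨l, rfl⟩ : ∃ l : Fin m, i = l.castSucc := ⟨⟨i, by omega⟩, rfl⟩
    obtain rfl : j = l.succ := Fin.ext (by simpa using hij.symm)
    have := hnext l (f l.castSucc) x y
    rwa [← hf] at this
  · intro i j hij x y hxy
    have hd := h4 i j hij
    rw [← hrange, ← hrange, Set.disjoint_left] at hd
    exact hd (Set.mem_range_self x) (hxy ▸ Set.mem_range_self y)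

/-! ### The subdivided ladder -/

theorem rungPos_zero {n : ℕ} (a : Fin n → ℕ) : rungPos a 0 = 0 := by
  simp [rungPos]

theorem rungPos_succ {n : ℕ} (a : Fin n → ℕ) (i : Fin n) :
    rungPos a ((i : ℕ) + 1) = rungPos a i + (a i + 1) := by
  have : Finset.univ.filter (fun j : Fin n => (j : ℕ) < i + 1) =
      insert i (Finset.univ.filter (fun j : Fin n => (j : ℕ) < i)) := by
    ext j
    simp only [Finset.mem_filter, Finset.mem_univ, true_and, Finset.mem_insert, Fin.ext_iff]
    omega
  rw [rungPos, this, Finset.sum_insert (by simp), add_comm]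
  rfl

theorem rungPos_mono {n : ℕ} (a : Fin n → ℕ) : Monotone (rungPos a) := by
  intro i j hij
  apply Finset.sum_le_sum_of_subset
  intro l
  simp only [Finset.mem_filter, Finset.mem_univ, true_and]
  omega

theorem rungPos_lt {n : ℕ} (a : Fin n → ℕ) {i j : ℕ} (hij : i < j) (hj : j ≤ n) :
    rungPos a i < rungPos a j := by
  have h1 := rungPos_succ a ⟨i, by omega⟩
  have h2 := rungPos_mono a (show i + 1 ≤ j from hij)
  simp only at h1
  omega

theorem rungPos_inj {n : ℕ} (a : Fin n → ℕ) {i j : ℕ} (hi : i ≤ n) (hj : j ≤ n)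
    (h : rungPos a i = rungPos a j) : i = j := by
  rcases lt_trichotomy i j with hij | hij | hij
  · have := rungPos_lt a hij hj
    omega
  · exact hij
  · have := rungPos_lt a hij hi
    omega

/-- Every edge of the top or bottom path belongs to one of the squares. -/
theorem exists_rungPos_le_lt {n : ℕ} (a : Fin n → ℕ) {x : ℕ} (hx : x < rungPos a n) :
    ∃ i : Fin n, rungPos a i ≤ x ∧ x < rungPos a ((i : ℕ) + 1) := by
  classical
  have hex : ∃ j, x < rungPos a j := ⟨n, hx⟩
  have h1 := Nat.find_spec hex
  have h2 : Nat.find hex ≤ n := Nat.find_min' hex hx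
  have h3 : Nat.find hex ≠ 0 := by
    intro h
    rw [h, rungPos_zero] at h1
    omega
  refine ⟨⟨Nat.find hex - 1, by omega⟩, ?_, ?_⟩
  · have := Nat.find_min hex (show Nat.find hex - 1 < Nat.find hex by omega)
    simpa using this
  · simpa [Nat.sub_add_cancel (Nat.one_le_iff_ne_zero.2 h3)] using h1

theorem exists_rungPos_le_le {n : ℕ} (hn : 1 ≤ n) (a : Fin n → ℕ) {x : ℕ} (hx : x ≤ rungPos a n) :
    ∃ i : Fin n, rungPos a i ≤ x ∧ x ≤ rungPos a ((i : ℕ) + 1) := by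
  rcases Nat.lt_or_ge x (rungPos a n) with h | h
  · obtain ⟨i, h1, h2⟩ := exists_rungPos_le_lt a h
    exact ⟨i, h1, h2.le⟩
  · refine ⟨⟨n - 1, by omega⟩, ?_, ?_⟩
    · exact (rungPos_mono a (by simp)).trans h
    · simpa [Nat.sub_add_cancel hn] using hx

theorem subdividedLadder_adj_inl_inl {n : ℕ} {a b : Fin n → ℕ} (x y : Fin (rungPos a n + 1)) :
    (subdividedLadder a b).Adj (Sum.inl x) (Sum.inl y) ↔ (x : ℕ) + 1 = y ∨ (y : ℕ) + 1 = x :=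
  Iff.rfl

theorem subdividedLadder_adj_inr_inr {n : ℕ} {a b : Fin n → ℕ} (x y : Fin (rungPos b n + 1)) :
    (subdividedLadder a b).Adj (Sum.inr x) (Sum.inr y) ↔ (x : ℕ) + 1 = y ∨ (y : ℕ) + 1 = x :=
  Iff.rfl

theorem subdividedLadder_adj_inl_inr {n : ℕ} {a b : Fin n → ℕ} (x : Fin (rungPos a n + 1))
    (y : Fin (rungPos b n + 1)) :
    (subdividedLadder a b).Adj (Sum.inl x) (Sum.inr y) ↔
      ∃ j ≤ n, (x : ℕ) = rungPos a j ∧ (y : ℕ) = rungPos b j :=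
  Iff.rfl

/-- The `x`-th vertex of the `i`-th polygon of the subdivided ladder: along the top path from one
rung to the next, then back along the bottom path. -/
def ladderPolygonFun {n : ℕ} (a b : Fin n → ℕ) (i : Fin n) (x : ℕ) : LadderVertex a b :=
  if x ≤ a i + 1 then Sum.inl (Fin.ofNat _ (rungPos a i + x))
  else Sum.inr (Fin.ofNat _ (rungPos b i + (a i + b i + 3 - x)))

theorem ladderPolygonFun_top {n : ℕ} (a b : Fin n → ℕ) (i : Fin n) {x : ℕ} (hx : x ≤ a i + 1)
    (h : rungPos a i + x < rungPos a n + 1) :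
    ladderPolygonFun a b i x = Sum.inl ⟨rungPos a i + x, h⟩ := by
  rw [ladderPolygonFun, if_pos hx]
  congr 1
  exact Fin.ext (Nat.mod_eq_of_lt h)

theorem ladderPolygonFun_bot {n : ℕ} (a b : Fin n → ℕ) (i : Fin n) {x : ℕ} (hx : a i + 1 < x)
    (h : rungPos b i + (a i + b i + 3 - x) < rungPos b n + 1) :
    ladderPolygonFun a b i x = Sum.inr ⟨rungPos b i + (a i + b i + 3 - x), h⟩ := by
  rw [ladderPolygonFun, if_neg (by omega)]
  congr 1
  exact Fin.ext (Nat.mod_eq_of_lt h)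

/-- Every vertex of a polygon of the subdivided ladder is either on its top or on its bottom. -/
theorem ladderPolygonFun_cases {n : ℕ} (a b : Fin n → ℕ) (i : Fin n) (x : ℕ) :
    (x ≤ a i + 1 ∧ ∃ h, ladderPolygonFun a b i x = Sum.inl ⟨rungPos a i + x, h⟩) ∨
    (a i + 1 < x ∧ ∃ h, ladderPolygonFun a b i x =
      Sum.inr ⟨rungPos b i + (a i + b i + 3 - x), h⟩) := by
  have ha := rungPos_succ a i
  have hb := rungPos_succ b i
  have ha' := rungPos_mono a (show (i : ℕ) + 1 ≤ n from i.isLt)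
  have hb' := rungPos_mono b (show (i : ℕ) + 1 ≤ n from i.isLt)
  rcases Nat.lt_or_ge (a i + 1) x with h | h
  · exact Or.inr ⟨h, by omega, ladderPolygonFun_bot a b i h _⟩
  · exact Or.inl ⟨h, by omega, ladderPolygonFun_top a b i h _⟩

/-- The rungs that meet the `i`-th polygon of a subdivided ladder are its two ends. -/
theorem exists_rungPos_iff {n : ℕ} (a b : Fin n → ℕ) (i : Fin n) {x y : ℕ} (hx : x ≤ a i + 1)
    (hy : y ≤ b i + 1) :
    (∃ j ≤ n, rungPos a i + x = rungPos a j ∧ rungPos b i + y = rungPos b j) ↔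
      (x = 0 ∧ y = 0) ∨ (x = a i + 1 ∧ y = b i + 1) := by
  have hi := i.isLt
  have ha := rungPos_succ a i
  have hb := rungPos_succ b i
  constructor
  · rintro ⟨j, hj, h1, h2⟩
    rcases lt_trichotomy j (i : ℕ) with h | h | h
    · have := rungPos_lt a h hi.le
      omega
    · subst h
      omega
    · rcases Nat.lt_or_ge ((i : ℕ) + 1) j with h' | h'
      · have := rungPos_lt a h' hj
        omega
      · obtain rfl : j = (i : ℕ) + 1 := by omega
        omega
  · rintro (⟨rfl, rfl⟩ | ⟨rfl, rfl⟩)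
    · exact ⟨i, hi.le, rfl, rfl⟩
    · exact ⟨i + 1, hi, ha.symm, hb.symm⟩

/-- The `i`-th polygon of the subdivided ladder. -/
def ladderPolygon {n : ℕ} {k a b : Fin n → ℕ} (hab : ∀ i, a i + b i + 4 = k i) (i : Fin n) :
    SimpleGraph.cycleGraph (k i) ↪g subdividedLadder a b where
  toFun x := ladderPolygonFun a b i x
  inj' := by
    intro x y hxy
    have hx := x.isLt
    have hy := y.isLt
    have hk := hab i
    simp only at hxy
    apply Fin.ext
    rcases ladderPolygonFun_cases a b i x with ⟨hx1, hx2, hx3⟩ | ⟨hx1, hx2, hx3⟩ <;>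
    rcases ladderPolygonFun_cases a b i y with ⟨hy1, hy2, hy3⟩ | ⟨hy1, hy2, hy3⟩ <;>
    simp only [hx3, hy3, Sum.inl.injEq, Sum.inr.injEq, Fin.mk.injEq, reduceCtorEq] at hxy <;>
    omega
  map_rel_iff' := by
    intro x y
    have hx := x.isLt
    have hy := y.isLt
    have hk := hab i
    show (subdividedLadder a b).Adj (ladderPolygonFun a b i x) (ladderPolygonFun a b i y) ↔ _
    rw [cycleGraph_adj_iff_val (by omega)]
    rcases ladderPolygonFun_cases a b i x with ⟨hx1, hx2, hx3⟩ | ⟨hx1, hx2, hx3⟩ <;>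
    rcases ladderPolygonFun_cases a b i y with ⟨hy1, hy2, hy3⟩ | ⟨hy1, hy2, hy3⟩ <;>
    rw [hx3, hy3]
    · rw [subdividedLadder_adj_inl_inl]
      dsimp only
      omega
    · rw [subdividedLadder_adj_inl_inr, exists_rungPos_iff a b i hx1 (by omega)]
      omega
    · rw [SimpleGraph.adj_comm, subdividedLadder_adj_inl_inr,
        exists_rungPos_iff a b i hy1 (by omega)]
      omega
    · rw [subdividedLadder_adj_inr_inr]
      dsimp only
      omega

theorem ladderPolygon_apply {n : ℕ} {k a b : Fin n → ℕ} (hab : ∀ i, a i + b i + 4 = k i)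
    (i : Fin n) (x : Fin (k i)) : ladderPolygon hab i x = ladderPolygonFun a b i x := rfl

theorem inl_mem_range_ladderPolygon {n : ℕ} {k a b : Fin n → ℕ} (hab : ∀ i, a i + b i + 4 = k i)
    (i : Fin n) (x : Fin (rungPos a n + 1)) (h1 : rungPos a i ≤ x)
    (h2 : (x : ℕ) ≤ rungPos a ((i : ℕ) + 1)) :
    Sum.inl x ∈ Set.range (ladderPolygon hab i) := by
  have hk := hab i
  rw [rungPos_succ] at h2
  refine ⟨⟨x - rungPos a i, by omega⟩, ?_⟩
  rw [ladderPolygon_apply, ladderPolygonFun_top a b i (by simp only; omega) (by simp only; omega)]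
  congr 1
  exact Fin.ext (by simp only; omega)

theorem inr_mem_range_ladderPolygon {n : ℕ} {k a b : Fin n → ℕ} (hab : ∀ i, a i + b i + 4 = k i)
    (i : Fin n) (x : Fin (rungPos b n + 1)) (h1 : rungPos b i ≤ x)
    (h2 : (x : ℕ) ≤ rungPos b ((i : ℕ) + 1)) :
    Sum.inr x ∈ Set.range (ladderPolygon hab i) := by
  have hk := hab i
  rw [rungPos_succ] at h2
  refine ⟨⟨a i + b i + 3 - (x - rungPos b i), by omega⟩, ?_⟩
  rw [ladderPolygon_apply, ladderPolygonFun_bot a b i (by simp only; omega) (by simp only; omega)]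
  congr 1
  exact Fin.ext (by simp only; omega)

theorem isChainParam_ladderPolygon {n : ℕ} (hn : 1 ≤ n) {k a b : Fin n → ℕ}
    (hab : ∀ i, a i + b i + 4 = k i) :
    IsChainParam k a (subdividedLadder a b) (ladderPolygon hab) := by
  have hrung : ∀ (x : Fin (rungPos a n + 1)) (y : Fin (rungPos b n + 1)),
      (∃ j ≤ n, (x : ℕ) = rungPos a j ∧ (y : ℕ) = rungPos b j) →
      ∃ i, Sum.inl x ∈ Set.range (ladderPolygon hab i) ∧
        Sum.inr y ∈ Set.range (ladderPolygon hab i) := by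
    rintro x y ⟨j, hj, hx, hy⟩
    rcases hj.lt_or_eq with h | rfl
    · refine ⟨⟨j, h⟩, inl_mem_range_ladderPolygon hab _ x hx.ge ?_,
        inr_mem_range_ladderPolygon hab _ y hy.ge ?_⟩
      · exact hx.le.trans (rungPos_mono a (by simp))
      · exact hy.le.trans (rungPos_mono b (by simp))
    · refine ⟨⟨j - 1, by omega⟩, inl_mem_range_ladderPolygon hab _ x ?_ ?_,
        inr_mem_range_ladderPolygon hab _ y ?_ ?_⟩
      · rw [hx]
        exact rungPos_mono a (by simp)
      · simp [hx, Nat.sub_add_cancel hn]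
      · rw [hy]
        exact rungPos_mono b (by simp)
      · simp [hy, Nat.sub_add_cancel hn]
  have htop : ∀ x y : Fin (rungPos a n + 1), (x : ℕ) + 1 = y →
      ∃ i, Sum.inl x ∈ Set.range (ladderPolygon hab i) ∧
        Sum.inl y ∈ Set.range (ladderPolygon hab i) := by
    intro x y hxy
    have hy := y.isLt
    obtain ⟨i, h1, h2⟩ := exists_rungPos_le_lt a (show (x : ℕ) < rungPos a n by omega)
    exact ⟨i, inl_mem_range_ladderPolygon hab i x h1 h2.le,
      inl_mem_range_ladderPolygon hab i y (by omega) (by omega)⟩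
  have hbot : ∀ x y : Fin (rungPos b n + 1), (x : ℕ) + 1 = y →
      ∃ i, Sum.inr x ∈ Set.range (ladderPolygon hab i) ∧
        Sum.inr y ∈ Set.range (ladderPolygon hab i) := by
    intro x y hxy
    have hy := y.isLt
    obtain ⟨i, h1, h2⟩ := exists_rungPos_le_lt b (show (x : ℕ) < rungPos b n by omega)
    exact ⟨i, inr_mem_range_ladderPolygon hab i x h1 h2.le,
      inr_mem_range_ladderPolygon hab i y (by omega) (by omega)⟩
  refine ⟨?_, ?_, ?_, ?_⟩
  · rintro (x | x)
    · obtain ⟨i, h1, h2⟩ := exists_rungPos_le_le hn a (Nat.lt_succ_iff.1 x.isLt)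
      exact ⟨i, inl_mem_range_ladderPolygon hab i x h1 h2⟩
    · obtain ⟨i, h1, h2⟩ := exists_rungPos_le_le hn b (Nat.lt_succ_iff.1 x.isLt)
      exact ⟨i, inr_mem_range_ladderPolygon hab i x h1 h2⟩
  · rintro (x | x) (y | y) h
    · rcases h with h | h
      · exact htop x y h
      · obtain ⟨i, h1, h2⟩ := htop y x h
        exact ⟨i, h2, h1⟩
    · exact hrung x y h
    · obtain ⟨i, h1, h2⟩ := hrung y x h
      exact ⟨i, h2, h1⟩
    · rcases h with h | h
      · exact hbot x y h
      · obtain ⟨i, h1, h2⟩ := hbot y x h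
        exact ⟨i, h2, h1⟩
  · intro i j hij x y
    have hx := x.isLt
    have hy := y.isLt
    have hki := hab i
    have hkj := hab j
    have ha := rungPos_succ a i
    have hb := rungPos_succ b i
    rw [hij] at ha hb
    rw [ladderPolygon_apply, ladderPolygon_apply]
    rcases ladderPolygonFun_cases a b i x with ⟨hx1, hx2, hx3⟩ | ⟨hx1, hx2, hx3⟩ <;>
    rcases ladderPolygonFun_cases a b j y with ⟨hy1, hy2, hy3⟩ | ⟨hy1, hy2, hy3⟩ <;>
    rw [hx3, hy3]
    · rw [Sum.inl.injEq, Fin.mk.injEq]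
      omega
    · exact iff_of_false Sum.inl_ne_inr (by omega)
    · exact iff_of_false Sum.inr_ne_inl (by omega)
    · rw [Sum.inr.injEq, Fin.mk.injEq]
      omega
  · intro i j hij x y
    have hx := x.isLt
    have hy := y.isLt
    have hki := hab i
    have hkj := hab j
    have ha := rungPos_succ a i
    have hb := rungPos_succ b i
    have ha' := rungPos_lt a hij j.isLt.le
    have hb' := rungPos_lt b hij j.isLt.le
    rw [ladderPolygon_apply, ladderPolygon_apply]
    intro hxy
    rcases ladderPolygonFun_cases a b i x with ⟨hx1, hx2, hx3⟩ | ⟨hx1, hx2, hx3⟩ <;>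
    rcases ladderPolygonFun_cases a b j y with ⟨hy1, hy2, hy3⟩ | ⟨hy1, hy2, hy3⟩ <;>
    simp only [hx3, hy3, Sum.inl.injEq, Sum.inr.injEq, Fin.mk.injEq, reduceCtorEq] at hxy <;>
    omega

/-! ### The Kirchhoff index from a Green function -/

theorem lapMatrix_mulVec_eq_sum {V : Type*} [Fintype V] [DecidableEq V] (G : SimpleGraph V)
    [DecidableRel G.Adj] (φ : V → ℝ) (x : V) :
    (G.lapMatrix ℝ).mulVec φ x = ∑ y, if G.Adj x y then φ x - φ y else 0 := by
  rw [SimpleGraph.lapMatrix_mulVec_apply, ← Finset.sum_filter,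
    ← SimpleGraph.neighborFinset_eq_filter, Finset.sum_sub_distrib, Finset.sum_const,
    SimpleGraph.card_neighborFinset_eq_degree, nsmul_eq_mul]

theorem isUnitFlowPotential_iff {V : Type*} [Fintype V] [DecidableEq V] (G : SimpleGraph V)
    [DecidableRel G.Adj] (u v : V) (φ : V → ℝ) :
    IsUnitFlowPotential G u v φ ↔
      (G.lapMatrix ℝ).mulVec φ = Pi.single u 1 - Pi.single v 1 := by
  unfold IsUnitFlowPotential
  constructor <;> intro h <;> convert h

theorem IsUnitFlowPotential.comp_iso {V W : Type*} [Fintype V] [Fintype W] {G : SimpleGraph V}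
    {G' : SimpleGraph W} (f : G ≃g G') {u v : W} {φ : W → ℝ}
    (h : IsUnitFlowPotential G' u v φ) :
    IsUnitFlowPotential G (f.symm u) (f.symm v) (φ ∘ f) := by
  classical
  rw [isUnitFlowPotential_iff] at h ⊢
  funext x
  have hx := congrFun h (f x)
  rw [lapMatrix_mulVec_eq_sum] at hx ⊢
  rw [← f.toEquiv.sum_comp] at hx
  simp only [RelIso.coe_fn_toEquiv, f.map_adj_iff] at hx
  simp only [Function.comp_apply]
  rw [hx]
  simp only [Pi.sub_apply, Pi.single_apply]
  congr 2 <;> exact propext (RelIso.eq_symm_apply f).symm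

theorem resistanceDist_iso {V W : Type*} [Fintype V] [Fintype W] {G : SimpleGraph V}
    {G' : SimpleGraph W} (f : G ≃g G') (u v : V) :
    resistanceDist G' (f u) (f v) = resistanceDist G u v := by
  by_cases h : ∃ φ, IsUnitFlowPotential G' (f u) (f v) φ
  · obtain ⟨φ, hφ⟩ := h
    have h' := hφ.comp_iso f
    rw [RelIso.symm_apply_apply, RelIso.symm_apply_apply] at h'
    rw [resistanceDist_eq hφ, resistanceDist_eq h']
    rfl
  · have h' : ¬ ∃ φ, IsUnitFlowPotential G u v φ := by
      rintro ⟨φ, hφ⟩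
      exact h ⟨_, hφ.comp_iso f.symm⟩
    rw [resistanceDist, resistanceDist, dif_neg h, dif_neg h']

theorem kirchhoffIndex_iso {V W : Type*} [Fintype V] [Fintype W] {G : SimpleGraph V}
    {G' : SimpleGraph W} (f : G ≃g G') : kirchhoffIndex G = kirchhoffIndex G' := by
  unfold kirchhoffIndex
  rw [← f.toEquiv.sum_comp]
  congr 1
  refine Finset.sum_congr rfl fun u _ => ?_
  rw [← f.toEquiv.sum_comp]
  exact Finset.sum_congr rfl fun v _ => (resistanceDist_iso f u v).symm

/-- The Kirchhoff index in terms of a Green function of the Laplacian, that is, the potentials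
`Γ u` of unit currents entering at `u` and leaving in a way independent of `u`. -/
theorem kirchhoffIndex_eq_of_green {V : Type*} [Fintype V] [DecidableEq V] (G : SimpleGraph V)
    [DecidableRel G.Adj] (Γ : V → V → ℝ) (c : V → ℝ)
    (h : ∀ u, (G.lapMatrix ℝ).mulVec (Γ u) = Pi.single u 1 - c) :
    kirchhoffIndex G = Fintype.card V * ∑ u, Γ u u - ∑ u, ∑ v, Γ u v := by
  have hr : ∀ u v, resistanceDist G u v = Γ u u - Γ u v - Γ v u + Γ v v := by
    intro u v
    have : IsUnitFlowPotential G u v (Γ u - Γ v) := by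
      rw [isUnitFlowPotential_iff, Matrix.mulVec_sub, h, h]
      abel
    rw [resistanceDist_eq this]
    simp only [Pi.sub_apply]
    ring
  unfold kirchhoffIndex
  simp only [hr, Finset.sum_add_distrib, Finset.sum_sub_distrib, Finset.sum_const,
    Finset.card_univ, nsmul_eq_mul, ← Finset.mul_sum]
  rw [Finset.sum_comm (f := fun u v => Γ v u)]
  ring

/-! ### Cycles with chords -/

/-- The cycle on `ZMod N` with additional edges between `p j` and `q j`. -/
def chordedCycle (N : ℕ) {ι : Type*} (p q : ι → ZMod N) : SimpleGraph (ZMod N) where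
  Adj x y := x ≠ y ∧ (y = x + 1 ∨ x = y + 1 ∨ ∃ j, (x = p j ∧ y = q j) ∨ (x = q j ∧ y = p j))
  symm := ⟨by
    rintro x y ⟨h, h1 | h1 | ⟨j, h1 | h1⟩⟩
    · exact ⟨h.symm, Or.inr (Or.inl h1)⟩
    · exact ⟨h.symm, Or.inl h1⟩
    · exact ⟨h.symm, Or.inr (Or.inr ⟨j, Or.inr h1.symm⟩)⟩
    · exact ⟨h.symm, Or.inr (Or.inr ⟨j, Or.inl h1.symm⟩)⟩⟩
  loopless := ⟨fun _ h => h.1 rfl⟩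

/-- The chords `p j, q j` have distinct ends and are not edges of the cycle. -/
structure IsChordFamily (N : ℕ) {ι : Type*} (p q : ι → ZMod N) : Prop where
  left_inj : Function.Injective p
  right_inj : Function.Injective q
  ne : ∀ i j, p i ≠ q j
  right_ne : ∀ j, q j ≠ p j + 1
  left_ne : ∀ j, p j ≠ q j + 1

/-- The Laplacian of the cycle on `ZMod N`. -/
def cycleLap {N : ℕ} (φ : ZMod N → ℝ) (x : ZMod N) : ℝ := 2 * φ x - φ (x + 1) - φ (x - 1)

theorem chordedCycle_indicator {N : ℕ} (hN : 3 ≤ N) {ι : Type*} [Fintype ι] {p q : ι → ZMod N}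
    (hpq : IsChordFamily N p q) (x y : ZMod N) [Decidable ((chordedCycle N p q).Adj x y)] :
    (if (chordedCycle N p q).Adj x y then (1 : ℝ) else 0) =
      (if y = x + 1 then 1 else 0) + (if y = x - 1 then 1 else 0) +
      ∑ j, ((if x = p j then 1 else 0) * (if y = q j then 1 else 0) +
        (if x = q j then 1 else 0) * (if y = p j then 1 else 0)) := by
  have hone : ((1 : ℕ) : ZMod N) ≠ 0 := by
    rw [Ne, ZMod.natCast_eq_zero_iff]
    exact fun h => by have := Nat.le_of_dvd one_pos h; omega
  have htwo : ((2 : ℕ) : ZMod N) ≠ 0 := by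
    rw [Ne, ZMod.natCast_eq_zero_iff]
    exact fun h => by have := Nat.le_of_dvd two_pos h; omega
  push_cast at hone htwo
  have hx1 : x ≠ x + 1 := by simpa using hone
  have hx2 : x + 1 ≠ x - 1 := by
    intro h
    apply htwo
    linear_combination h
  obtain ⟨h1, h2, h3, h4, h5⟩ := hpq
  by_cases hy1 : y = x + 1
  · subst hy1
    rw [if_pos ⟨hx1, Or.inl rfl⟩, if_pos rfl, if_neg hx2, Finset.sum_eq_zero]
    · norm_num
    · intro j _
      by_cases hp : x = p j
      · subst hp
        rw [if_neg (h3 j j), if_neg (h4 j).symm]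
        simp
      · rw [if_neg hp]
        by_cases hq : x = q j
        · subst hq
          rw [if_neg (h5 j).symm]
          simp
        · rw [if_neg hq]
          simp
  by_cases hy2 : y = x - 1
  · have hy2' : x = y + 1 := by rw [hy2]; ring
    rw [if_pos ⟨by rw [hy2]; intro h; exact hone (by linear_combination h), Or.inr (Or.inl hy2')⟩,
      if_neg hy1, if_pos hy2, Finset.sum_eq_zero]
    · norm_num
    · intro j _
      by_cases hp : y = p j
      · rw [hp, if_neg (h3 j j), if_neg fun h : x = q j => h4 j (by rw [← h, hy2', hp])]
        simp
      · rw [if_neg hp]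
        by_cases hq : y = q j
        · rw [hq, if_neg fun h : x = p j => h5 j (by rw [← h, hy2', hq])]
          simp
        · rw [if_neg hq]
          simp
  rw [if_neg hy1, if_neg hy2]
  by_cases hj : ∃ j, (x = p j ∧ y = q j) ∨ (x = q j ∧ y = p j)
  · rw [if_pos]
    · obtain ⟨j, ⟨rfl, rfl⟩ | ⟨rfl, rfl⟩⟩ := hj
      · rw [Finset.sum_eq_single j]
        · simp [h3 j j]
        · intro l _ hl
          rw [if_neg fun h => hl (h1 h).symm, if_neg (h3 j l)]
          simp
        · simp
      · rw [Finset.sum_eq_single j]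
        · simp [(h3 j j).symm]
        · intro l _ hl
          rw [if_neg (h3 l j).symm, if_neg fun h => hl (h2 h).symm]
          simp
        · simp
    · refine ⟨?_, Or.inr (Or.inr hj)⟩
      obtain ⟨j, ⟨rfl, rfl⟩ | ⟨rfl, rfl⟩⟩ := hj
      · exact h3 j j
      · exact (h3 j j).symm
  · rw [if_neg, Finset.sum_eq_zero]
    · norm_num
    · intro j _
      by_cases hp : x = p j
      · rw [if_neg (fun h : y = q j => hj ⟨j, Or.inl ⟨hp, h⟩⟩),
          if_neg (fun h : x = q j => h3 j j (hp.symm.trans h))]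
        simp
      · rw [if_neg hp]
        by_cases hq : x = q j
        · rw [if_neg (fun h : y = p j => hj ⟨j, Or.inr ⟨hq, h⟩⟩)]
          simp
        · rw [if_neg hq]
          simp
    · rintro ⟨-, h | h | h⟩
      · exact hy1 h
      · exact hy2 (by rw [h]; ring)
      · exact hj h

theorem lapMatrix_chordedCycle_mulVec {N : ℕ} [NeZero N] (hN : 3 ≤ N) {ι : Type*} [Fintype ι]
    {p q : ι → ZMod N} (hpq : IsChordFamily N p q) [DecidableRel (chordedCycle N p q).Adj]
    (φ : ZMod N → ℝ) (x : ZMod N) :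
    ((chordedCycle N p q).lapMatrix ℝ).mulVec φ x = cycleLap φ x +
      ∑ j, ((if x = q j then 1 else 0) - (if x = p j then 1 else 0)) * (φ (q j) - φ (p j)) := by
  rw [lapMatrix_mulVec_eq_sum]
  have h : ∀ y, (if (chordedCycle N p q).Adj x y then φ x - φ y else 0) =
      (if y = x + 1 then φ x - φ y else 0) + (if y = x - 1 then φ x - φ y else 0) +
      ∑ j, ((if x = p j then 1 else 0) * (if y = q j then φ x - φ y else 0) +
        (if x = q j then 1 else 0) * (if y = p j then φ x - φ y else 0)) := by
    intro y
    have := congrArg (fun t => t * (φ x - φ y)) (chordedCycle_indicator hN hpq x y)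
    simp only [add_mul, Finset.sum_mul, ite_mul, one_mul, zero_mul] at this ⊢
    exact this
  simp only [h, Finset.sum_add_distrib]
  rw [Finset.sum_comm, Finset.sum_comm (s := Finset.univ (α := ZMod N))]
  simp only [← Finset.mul_sum, Finset.sum_ite_eq', Finset.mem_univ, if_true]
  congr 1
  · unfold cycleLap
    ring
  · rw [← Finset.sum_add_distrib]
    refine Finset.sum_congr rfl fun j _ => ?_
    by_cases hp : x = p j
    · have hq : x ≠ q j := fun h => hpq.ne j j (hp.symm.trans h)
      rw [if_pos hp, if_neg hq, hp]
      ring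
    · by_cases hq : x = q j
      · rw [if_neg hp, if_pos hq, hq]
        ring
      · rw [if_neg hp, if_neg hq]
        ring

/-! ### Green functions of the cycle -/

/-- The product of the lengths of the two arcs between `0` and `d` in the cycle on `ZMod N`. -/
def arcProd {N : ℕ} (d : ZMod N) : ℝ := d.val * (N - d.val)

theorem arcProd_natCast {N n : ℕ} [NeZero N] (hn : n ≤ N) :
    arcProd (n : ZMod N) = n * (N - n) := by
  rcases hn.lt_or_eq with h | rfl
  · rw [arcProd, ZMod.val_natCast_of_lt h]
  · simp [arcProd]

theorem arcProd_neg {N : ℕ} [NeZero N] (d : ZMod N) : arcProd (-d) = arcProd d := by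
  have hd := d.val_lt
  have h : -d = ((N - d.val : ℕ) : ZMod N) := by
    rw [Nat.cast_sub hd.le, ZMod.natCast_self, ZMod.natCast_zmod_val, zero_sub]
  rw [h, arcProd_natCast (Nat.sub_le _ _), arcProd, Nat.cast_sub hd.le]
  ring

theorem arcProd_add_one {N : ℕ} [NeZero N] (d : ZMod N) :
    arcProd (d + 1) = (d.val + 1) * (N - d.val - 1) := by
  have hd := d.val_lt
  have h : d + 1 = ((d.val + 1 : ℕ) : ZMod N) := by
    rw [Nat.cast_add, ZMod.natCast_zmod_val, Nat.cast_one]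
  rw [h, arcProd_natCast (show d.val + 1 ≤ N from hd), Nat.cast_add, Nat.cast_one]
  ring

theorem arcProd_sub_one {N : ℕ} [NeZero N] {d : ZMod N} (hd0 : d ≠ 0) :
    arcProd (d - 1) = (d.val - 1) * (N - d.val + 1) := by
  have hd := d.val_lt
  have hpos : 1 ≤ d.val := Nat.one_le_iff_ne_zero.2 ((ZMod.val_ne_zero d).2 hd0)
  have h : d - 1 = ((d.val - 1 : ℕ) : ZMod N) := by
    rw [Nat.cast_sub hpos, ZMod.natCast_zmod_val, Nat.cast_one]
  rw [h, arcProd_natCast (by omega), Nat.cast_sub hpos, Nat.cast_one]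
  ring

theorem arcProd_zero {N : ℕ} : arcProd (0 : ZMod N) = 0 := by
  cases N <;> simp [arcProd]

/-- The Green function of the cycle on `ZMod N`. -/
noncomputable def cycleGreen {N : ℕ} (d : ZMod N) : ℝ := -arcProd d / (2 * N)

/-- The Green function of the square of the Laplacian of the cycle on `ZMod N`, up to an additive
constant. -/
noncomputable def cycleBigreen {N : ℕ} (d : ZMod N) : ℝ :=
  -(arcProd d ^ 2 + 2 * arcProd d) / (24 * N)

theorem cycleGreen_neg {N : ℕ} [NeZero N] (d : ZMod N) : cycleGreen (-d) = cycleGreen d := by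
  rw [cycleGreen, arcProd_neg, cycleGreen]

theorem cycleBigreen_neg {N : ℕ} [NeZero N] (d : ZMod N) :
    cycleBigreen (-d) = cycleBigreen d := by
  rw [cycleBigreen, arcProd_neg, cycleBigreen]

theorem cycleLap_sub {N : ℕ} (f g : ZMod N → ℝ) (x : ZMod N) :
    cycleLap (fun x => f x - g x) x = cycleLap f x - cycleLap g x := by
  unfold cycleLap
  ring

theorem cycleLap_comp_sub {N : ℕ} (f : ZMod N → ℝ) (u x : ZMod N) :
    cycleLap (fun x => f (x - u)) x = cycleLap f (x - u) := by
  show 2 * f (x - u) - f (x + 1 - u) - f (x - 1 - u) = _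
  rw [add_sub_right_comm, sub_right_comm x 1 u]
  rfl

theorem cycleLap_cycleGreen {N : ℕ} [NeZero N] (d : ZMod N) :
    cycleLap cycleGreen d = (if d = 0 then 1 else 0) - 1 / N := by
  have hN : (N : ℝ) ≠ 0 := NeZero.ne _
  unfold cycleLap cycleGreen
  by_cases hd : d = 0
  · subst hd
    rw [zero_sub, arcProd_neg, arcProd_zero, if_pos rfl]
    have := arcProd_add_one (0 : ZMod N)
    rw [zero_add] at this ⊢
    rw [ZMod.val_zero] at this
    rw [this]
    field_simp
    push_cast
    ring
  · rw [arcProd_add_one, arcProd_sub_one hd, if_neg hd, arcProd]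
    field_simp
    ring

theorem cycleLap_cycleBigreen {N : ℕ} [NeZero N] (d : ZMod N) :
    cycleLap cycleBigreen d = cycleGreen d + ((N : ℝ) ^ 2 - 1) / (12 * N) := by
  have hN : (N : ℝ) ≠ 0 := NeZero.ne _
  unfold cycleLap cycleBigreen cycleGreen
  by_cases hd : d = 0
  · subst hd
    rw [zero_sub, arcProd_neg, arcProd_zero]
    have := arcProd_add_one (0 : ZMod N)
    rw [zero_add] at this ⊢
    rw [ZMod.val_zero] at this
    rw [this]
    field_simp
    push_cast
    ring
  · rw [arcProd_add_one, arcProd_sub_one hd, arcProd]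
    field_simp
    ring

theorem sum_mul_cycleLap {N : ℕ} [NeZero N] (f g : ZMod N → ℝ) :
    ∑ x, f x * cycleLap g x = ∑ x, cycleLap f x * g x := by
  have h1 : ∑ x, f x * g (x + 1) = ∑ x, f (x - 1) * g x := by
    rw [← (Equiv.subRight (1 : ZMod N)).sum_comp fun x => f x * g (x + 1)]
    simp
  have h2 : ∑ x, f x * g (x - 1) = ∑ x, f (x + 1) * g x := by
    rw [← Equiv.sum_comp (Equiv.addRight (1 : ZMod N)) fun x => f x * g (x - 1)]
    simp
  unfold cycleLap
  simp only [mul_sub, sub_mul, Finset.sum_sub_distrib, h1, h2]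
  have h3 : ∑ x, f x * (2 * g x) = ∑ x, 2 * f x * g x :=
    Finset.sum_congr rfl fun x _ => by ring
  rw [h3]
  ring

/-- The potential at `x` of a unit current that enters the cycle at `q` and leaves it at `p`, when
`F` is the Green function of the cycle. -/
def dipole {N : ℕ} (F : ZMod N → ℝ) (p q x : ZMod N) : ℝ := F (x - q) - F (x - p)

/-- The interaction of two chords of the cycle through the kernel `F`. -/
def chordPairing {N : ℕ} (F : ZMod N → ℝ) (p q p' q' : ZMod N) : ℝ :=
  dipole F p' q' q - dipole F p' q' p

theorem cycleLap_dipole_cycleGreen {N : ℕ} [NeZero N] (p q x : ZMod N) :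
    cycleLap (dipole cycleGreen p q) x = (if x = q then 1 else 0) - (if x = p then 1 else 0) := by
  have : dipole cycleGreen p q = fun x => cycleGreen (x - q) - cycleGreen (x - p) := rfl
  rw [this, cycleLap_sub, cycleLap_comp_sub, cycleLap_comp_sub, cycleLap_cycleGreen,
    cycleLap_cycleGreen]
  simp only [sub_eq_zero]
  ring

theorem cycleLap_dipole_cycleBigreen {N : ℕ} [NeZero N] (p q x : ZMod N) :
    cycleLap (dipole cycleBigreen p q) x = dipole cycleGreen p q x := by
  have : dipole cycleBigreen p q = fun x => cycleBigreen (x - q) - cycleBigreen (x - p) := rfl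
  rw [this, cycleLap_sub, cycleLap_comp_sub, cycleLap_comp_sub, cycleLap_cycleBigreen,
    cycleLap_cycleBigreen, dipole]
  ring

theorem sum_dipole {N : ℕ} [NeZero N] (F : ZMod N → ℝ) (p q : ZMod N) :
    ∑ x, dipole F p q x = 0 := by
  have h : ∀ u, ∑ x, F (x - u) = ∑ x, F x := fun u => (Equiv.subRight u).sum_comp F
  simp only [dipole, Finset.sum_sub_distrib, h, sub_self]

theorem sum_dipole_mul_dipole {N : ℕ} [NeZero N] (p q p' q' : ZMod N) :
    ∑ x, dipole cycleGreen p q x * dipole cycleGreen p' q' x =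
      chordPairing cycleBigreen p q p' q' := by
  simp only [← cycleLap_dipole_cycleBigreen p' q']
  rw [sum_mul_cycleLap]
  simp only [cycleLap_dipole_cycleGreen, sub_mul, ite_mul, one_mul, zero_mul,
    Finset.sum_sub_distrib, Finset.sum_ite_eq', Finset.mem_univ, if_true]
  rfl

/-- The Kirchhoff index of a cycle with chords. The matrix `K` is the inverse of `1 + R`, where
`R j l` is the potential difference along the chord `l` that a unit current along the chord `j`
produces in the cycle. -/
theorem kirchhoffIndex_chordedCycle {N : ℕ} [NeZero N] (hN : 3 ≤ N) {ι : Type*} [Fintype ι]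
    [DecidableEq ι] {p q : ι → ZMod N} (hpq : IsChordFamily N p q) (K : Matrix ι ι ℝ)
    (hK : (1 + Matrix.of fun j l => chordPairing cycleGreen (p j) (q j) (p l) (q l)) * K = 1) :
    kirchhoffIndex (chordedCycle N p q) =
      (N * ∑ u : ZMod N, cycleGreen (u - u) - ∑ u : ZMod N, ∑ v : ZMod N, cycleGreen (v - u)) -
        N * ∑ j, ∑ l, K j l * chordPairing cycleBigreen (p j) (q j) (p l) (q l) := by
  classical
  set φ : ι → ZMod N → ℝ := fun j => dipole cycleGreen (p j) (q j) with hφ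
  have hφl : ∀ j x, cycleLap (φ j) x = (if x = q j then 1 else 0) - (if x = p j then 1 else 0) :=
    fun j x => cycleLap_dipole_cycleGreen _ _ _
  have hK' : ∀ j l, K j l + ∑ i, (φ i (q j) - φ i (p j)) * K i l = if j = l then 1 else 0 := by
    intro j l
    have := congrFun (congrFun hK j) l
    rw [add_mul, one_mul, Matrix.add_apply, Matrix.mul_apply, Matrix.one_apply] at this
    exact this
  let Γ : ZMod N → ZMod N → ℝ := fun u x =>
    cycleGreen (x - u) - ∑ j, ∑ l, K j l * φ l u * φ j x
  have hΓ : ∀ u, ((chordedCycle N p q).lapMatrix ℝ).mulVec (Γ u) =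
      Pi.single u 1 - fun _ => 1 / (N : ℝ) := by
    intro u
    funext x
    rw [lapMatrix_chordedCycle_mulVec hN hpq]
    have e1 : cycleLap (Γ u) x = ((if x = u then 1 else 0) - 1 / N) -
        ∑ j, ((if x = q j then 1 else 0) - (if x = p j then 1 else 0)) * ∑ l, K j l * φ l u := by
      have : cycleLap (Γ u) x = cycleLap (fun x => cycleGreen (x - u)) x -
          ∑ j, cycleLap (φ j) x * ∑ l, K j l * φ l u := by
        simp only [cycleLap, Γ, Finset.mul_sum, sub_mul, Finset.sum_sub_distrib]
        have h1 : ∀ y, ∑ j, ∑ l, φ j y * (K j l * φ l u) = ∑ j, ∑ l, K j l * φ l u * φ j y :=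
          fun y => Finset.sum_congr rfl fun j _ => Finset.sum_congr rfl fun l _ => by ring
        have h2 : ∑ j, ∑ l, 2 * φ j x * (K j l * φ l u) =
            2 * ∑ j, ∑ l, K j l * φ l u * φ j x := by
          simp only [Finset.mul_sum]
          exact Finset.sum_congr rfl fun j _ => Finset.sum_congr rfl fun l _ => by ring
        rw [h1, h1, h2]
        ring
      rw [this, cycleLap_comp_sub, cycleLap_cycleGreen]
      simp only [hφl, sub_eq_zero]
    have e2 : ∀ j, Γ u (q j) - Γ u (p j) = ∑ l, K j l * φ l u := by
      intro j
      have e3 : cycleGreen (q j - u) - cycleGreen (p j - u) = φ j u := by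
        rw [hφ, ← cycleGreen_neg (q j - u), ← cycleGreen_neg (p j - u), neg_sub, neg_sub]
        rfl
      have e4 : ∑ l, (K j l + ∑ i, (φ i (q j) - φ i (p j)) * K i l) * φ l u = φ j u := by
        simp only [hK', ite_mul, one_mul, zero_mul, Finset.sum_ite_eq, Finset.mem_univ, if_true]
      have e5 : ∑ l, (∑ i, (φ i (q j) - φ i (p j)) * K i l) * φ l u =
          ∑ i, ∑ l, K i l * φ l u * φ i (q j) - ∑ i, ∑ l, K i l * φ l u * φ i (p j) := by
        simp only [Finset.sum_mul, ← Finset.sum_sub_distrib]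
        rw [Finset.sum_comm]
        exact Finset.sum_congr rfl fun i _ => Finset.sum_congr rfl fun l _ => by ring
      simp only [add_mul, Finset.sum_add_distrib] at e4
      rw [e5] at e4
      simp only [Γ]
      linarith
    simp only [e1, e2, Pi.sub_apply, Pi.single_apply]
    ring
  rw [kirchhoffIndex_eq_of_green _ Γ _ hΓ, ZMod.card]
  have s1 : ∑ u, Γ u u = ∑ u : ZMod N, cycleGreen (u - u) -
      ∑ j, ∑ l, K j l * chordPairing cycleBigreen (p j) (q j) (p l) (q l) := by
    simp only [Γ, Finset.sum_sub_distrib]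
    congr 1
    rw [Finset.sum_comm]
    refine Finset.sum_congr rfl fun j _ => ?_
    rw [Finset.sum_comm]
    refine Finset.sum_congr rfl fun l _ => ?_
    rw [← sum_dipole_mul_dipole, Finset.mul_sum]
    exact Finset.sum_congr rfl fun x _ => by rw [hφ]; ring
  have s2 : ∑ u, ∑ v, Γ u v = ∑ u : ZMod N, ∑ v : ZMod N, cycleGreen (v - u) := by
    refine Finset.sum_congr rfl fun u _ => ?_
    simp only [Γ, Finset.sum_sub_distrib]
    rw [sub_eq_self, Finset.sum_comm]
    refine Finset.sum_eq_zero fun j _ => ?_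
    rw [Finset.sum_comm]
    refine Finset.sum_eq_zero fun l _ => ?_
    rw [← Finset.mul_sum, hφ, sum_dipole, mul_zero]
  rw [s1, s2]
  ring

/-- The interaction of two nested chords. The first chord joins `-α` to `β + 1`, the second one
joins `-(α + v)` to `β + u + 1`. -/
theorem chordPairing_nested {N α β u v : ℕ} (h : α + v + (β + u) + 1 ≤ N) (f : ℝ → ℝ) :
    chordPairing (fun d : ZMod N => f (arcProd d)) (-(α : ZMod N)) (β + 1)
      (-((α + v : ℕ) : ZMod N)) ((β + u : ℕ) + 1) =
      f (u * (N - u)) + f (v * (N - v)) -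
        f ((α + β + 1 + u) * (N - (α + β + 1 + u))) -
        f ((α + β + 1 + v) * (N - (α + β + 1 + v))) := by
  have : NeZero N := ⟨by omega⟩
  have e1 : (β + 1 - ((β + u : ℕ) + 1) : ZMod N) = -(u : ℕ) := by push_cast; ring
  have e2 : (-(α : ZMod N) - -((α + v : ℕ) : ZMod N)) = (v : ℕ) := by push_cast; ring
  have e3 : (-(α : ZMod N) - ((β + u : ℕ) + 1)) = -((α + β + 1 + u : ℕ) : ZMod N) := by
    push_cast; ring
  have e4 : (β + 1 - -((α + v : ℕ) : ZMod N)) = ((α + β + 1 + v : ℕ) : ZMod N) := by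
    push_cast; ring
  simp only [chordPairing, dipole]
  rw [e1, e2, e3, e4, arcProd_neg, arcProd_neg, arcProd_natCast (by omega),
    arcProd_natCast (by omega), arcProd_natCast (by omega), arcProd_natCast (by omega)]
  push_cast
  ring

theorem chordPairing_cycleGreen_nested {N α β u v : ℕ} (h : α + v + (β + u) + 1 ≤ N) :
    chordPairing (cycleGreen (N := N)) (-(α : ZMod N)) (β + 1)
      (-((α + v : ℕ) : ZMod N)) ((β + u : ℕ) + 1) =
      (α + β + 1) * (N - (α + v + (β + u) + 1)) / N := by
  have hN : (N : ℝ) ≠ 0 := by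
    rw [Nat.cast_ne_zero]
    omega
  have := chordPairing_nested h (fun t => -t / (2 * N))
  refine Eq.trans this ?_
  field_simp
  ring

/-- The interaction of two nested chords through the biharmonic Green function, as the sum of a
term that depends only on the lengths of the arcs they cut off, and a multiple of the square of
the displacement of their centres. -/
theorem chordPairing_cycleBigreen_nested {N α β u v : ℕ} (h : α + v + (β + u) + 1 ≤ N) :
    chordPairing (cycleBigreen (N := N)) (-(α : ZMod N)) (β + 1)
      (-((α + v : ℕ) : ZMod N)) ((β + u : ℕ) + 1) =
      (α + β + 1) * (N - (α + v + (β + u) + 1)) * (2 * N * (α + v + (β + u) + 1) - (u + v) ^ 2 -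
        2 * (α + β + 1) * (α + v + (β + u) + 1) + 4) / (24 * N) -
      (α + β + 1) * (N - (α + v + (β + u) + 1)) / (8 * N) * (u - v) ^ 2 := by
  have hN : (N : ℝ) ≠ 0 := by
    rw [Nat.cast_ne_zero]
    omega
  have := chordPairing_nested h (fun t => -(t ^ 2 + 2 * t) / (24 * N))
  refine Eq.trans this ?_
  field_simp
  ring

/-! ### The kernel of the nested chords -/

/-- The Green function of the second derivative on `[0, N]` with zero boundary values, at the
points `L i` and `L j` of an increasing sequence. -/
noncomputable def bridgeKernel (N : ℝ) (L : ℕ → ℝ) (i j : ℕ) : ℝ :=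
  L (min i j) * (N - L (max i j)) / N

/-- The function `∑ j, x j * bridgeKernel N L · (j + 1)`. -/
noncomputable def bridgePotential (N : ℝ) (L : ℕ → ℝ) {m : ℕ} (x : Fin m → ℝ) (i : ℕ) : ℝ :=
  ∑ j : Fin m, bridgeKernel N L i (j + 1) * x j

theorem bridgeKernel_comm (N : ℝ) (L : ℕ → ℝ) (i j : ℕ) :
    bridgeKernel N L i j = bridgeKernel N L j i := by
  rw [bridgeKernel, min_comm, max_comm, bridgeKernel]

theorem bridgePotential_zero {N : ℝ} {L : ℕ → ℝ} (hL0 : L 0 = 0) {m : ℕ} (x : Fin m → ℝ) :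
    bridgePotential N L x 0 = 0 :=
  Finset.sum_eq_zero fun j _ => by simp [bridgeKernel, hL0]

theorem bridgePotential_last {N : ℝ} {L : ℕ → ℝ} {m : ℕ} (hLm : L (m + 1) = N) (x : Fin m → ℝ) :
    bridgePotential N L x (m + 1) = 0 := by
  refine Finset.sum_eq_zero fun j _ => ?_
  have hj := j.isLt
  rw [bridgeKernel, max_eq_left (by omega), hLm]
  simp

/-- The bridge potential is piecewise linear, with slopes jumping by `x i` at `L (i + 1)`. -/
theorem bridgePotential_second_difference {N : ℝ} (hN : N ≠ 0) (L : ℕ → ℝ) {m : ℕ}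
    (x : Fin m → ℝ) (i : Fin m) :
    (L (i + 2) - L (i + 1)) * (bridgePotential N L x (i + 1) - bridgePotential N L x i) +
      (L (i + 1) - L i) * (bridgePotential N L x (i + 1) - bridgePotential N L x (i + 2)) =
      (L (i + 1) - L i) * (L (i + 2) - L (i + 1)) * x i := by
  have key : ∀ j : Fin m,
      (L (i + 2) - L (i + 1)) * (bridgeKernel N L (i + 1) (j + 1) - bridgeKernel N L i (j + 1)) +
      (L (i + 1) - L i) *
        (bridgeKernel N L (i + 1) (j + 1) - bridgeKernel N L (i + 2) (j + 1)) =
      if j = i then (L (i + 1) - L i) * (L (i + 2) - L (i + 1)) else 0 := by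
    intro j
    unfold bridgeKernel
    rcases lt_trichotomy (j : ℕ) i with h | h | h
    · rw [if_neg (fun hji => by rw [hji] at h; omega), min_eq_right (by omega),
        min_eq_right (by omega), min_eq_right (by omega), max_eq_left (by omega),
        max_eq_left (by omega), max_eq_left (by omega)]
      field_simp
      ring
    · rw [if_pos (Fin.ext h), h, min_self, max_self, min_eq_left (by omega),
        max_eq_right (by omega), min_eq_right (by omega), max_eq_left (by omega)]
      field_simp
      ring
    · rw [if_neg (fun hji => by rw [hji] at h; omega), min_eq_left (by omega),
        min_eq_left (by omega), min_eq_left (by omega), max_eq_right (by omega),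
        max_eq_right (by omega), max_eq_right (by omega)]
      field_simp
      ring
  have := Finset.sum_congr (rfl : (Finset.univ : Finset (Fin m)) = Finset.univ)
    fun j _ => congrArg (fun t => t * x j) (key j)
  simp only [ite_mul, zero_mul, Finset.sum_ite_eq', Finset.mem_univ, if_true] at this
  rw [← this]
  unfold bridgePotential
  simp only [← Finset.sum_sub_distrib, Finset.mul_sum, ← Finset.sum_add_distrib]
  exact Finset.sum_congr rfl fun j _ => by ring

/-- Maximum principle: the potential is concave wherever it is negative. -/
theorem bridgePotential_nonneg {N : ℝ} (hN : N ≠ 0) {L : ℕ → ℝ} {m : ℕ} (hL0 : L 0 = 0)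
    (hLm : L (m + 1) = N) (hL : ∀ i ≤ m, L i < L (i + 1)) (x : Fin m → ℝ)
    (hx : ∀ j : Fin m, 0 ≤ x j + bridgePotential N L x (j + 1)) (i : ℕ) (hi : i ≤ m + 1) :
    0 ≤ bridgePotential N L x i := by
  obtain ⟨l, hl, hmin⟩ := Finset.exists_min_image (Finset.range (m + 2)) (bridgePotential N L x)
    ⟨0, by simp⟩
  rw [Finset.mem_range] at hl
  refine le_trans ?_ (hmin i (by rw [Finset.mem_range]; omega))
  by_contra! hneg
  have hl0 : l ≠ 0 := by
    rintro rfl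
    rw [bridgePotential_zero hL0] at hneg
    exact lt_irrefl _ hneg
  have hlm : l ≠ m + 1 := by
    rintro rfl
    rw [bridgePotential_last hLm] at hneg
    exact lt_irrefl _ hneg
  obtain ⟨j, rfl⟩ : ∃ j : Fin m, l = j + 1 := ⟨⟨l - 1, by omega⟩, by simp only; omega⟩
  have hj := j.isLt
  have h1 := hmin j (by rw [Finset.mem_range]; omega)
  have h2 := hmin (j + 2) (by rw [Finset.mem_range]; omega)
  have h3 := sub_pos.2 (hL j (by omega))
  have h4 := sub_pos.2 (hL (j + 1) (by omega))
  have h5 : 0 < x j := by have := hx j; linarith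
  have h6 := bridgePotential_second_difference hN L x j
  have h7 := mul_pos (mul_pos h3 h4) h5
  have h8 := mul_nonpos_of_nonneg_of_nonpos h4.le (sub_nonpos.2 h1)
  have h9 := mul_nonpos_of_nonneg_of_nonpos h3.le (sub_nonpos.2 h2)
  linarith

/-- The inverse of `1 + R`, where `R` is the bridge kernel, has nonpositive entries off the
diagonal; that they are in fact negative is only needed for a corner. -/
theorem exists_inverse_one_add_bridgeKernel {N : ℝ} (hN : N ≠ 0) {L : ℕ → ℝ} {m : ℕ}
    (hL0 : L 0 = 0) (hLm : L (m + 1) = N) (hL : ∀ i ≤ m, L i < L (i + 1)) :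
    ∃ K : Matrix (Fin m) (Fin m) ℝ,
      (1 + Matrix.of fun i j : Fin m => bridgeKernel N L (i + 1) (j + 1)) * K = 1 ∧
      (∀ i j, i ≠ j → K i j ≤ 0) ∧
      ∀ i j : Fin m, i ≠ j → (i : ℕ) = 0 → (j : ℕ) + 1 = m → K i j < 0 := by
  set R : Matrix (Fin m) (Fin m) ℝ :=
    Matrix.of fun i j : Fin m => bridgeKernel N L (i + 1) (j + 1) with hR
  have hmul : ∀ (x : Fin m → ℝ) i,
      (1 + R).mulVec x i = x i + bridgePotential N L x (i + 1) := by
    intro x i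
    rw [Matrix.add_mulVec, Matrix.one_mulVec]
    rfl
  have hinj : Function.Injective (1 + R).mulVec := by
    have hker : ∀ x : Fin m → ℝ, (1 + R).mulVec x = 0 → ∀ i, x i ≤ 0 := by
      intro x hx i
      have h1 : ∀ i, x i + bridgePotential N L x (i + 1) = 0 := fun i => by
        rw [← hmul, hx, Pi.zero_apply]
      have h2 := bridgePotential_nonneg hN hL0 hLm hL x (fun i => (h1 i).ge) (i + 1) (by omega)
      linarith [h1 i]
    intro x y hxy
    have h1 := hker (x - y) (by rw [Matrix.mulVec_sub, hxy, sub_self])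
    have h2 := hker (y - x) (by rw [Matrix.mulVec_sub, hxy, sub_self])
    funext i
    have h1' := h1 i
    have h2' := h2 i
    simp only [Pi.sub_apply] at h1' h2'
    linarith
  have hunit : IsUnit (1 + R) := Matrix.mulVec_injective_iff_isUnit.1 hinj
  have hK : (1 + R) * (1 + R)⁻¹ = 1 :=
    Matrix.mul_nonsing_inv _ ((Matrix.isUnit_iff_isUnit_det _).1 hunit)
  set K := (1 + R)⁻¹
  have hcol : ∀ i j, K i j + bridgePotential N L (fun l => K l j) (i + 1) =
      if i = j then 1 else 0 := by
    intro i j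
    have := congrFun (congrFun hK i) j
    rw [Matrix.one_apply] at this
    rw [← this]
    exact (hmul (fun l => K l j) i).symm
  have hpos : ∀ (j : Fin m) (i : ℕ), i ≤ m + 1 → 0 ≤ bridgePotential N L (fun l => K l j) i := by
    intro j
    refine bridgePotential_nonneg hN hL0 hLm hL _ fun i => ?_
    rw [hcol]
    split_ifs <;> norm_num
  refine ⟨K, hK, ?_, ?_⟩
  · intro i j hij
    have h1 := hcol i j
    have h2 := hpos j (i + 1) (by omega)
    rw [if_neg hij] at h1
    linarith
  · intro i j hij hi hj
    have h1 := hcol i j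
    have h2 := hpos j (i + 1) (by omega)
    rw [if_neg hij] at h1
    suffices bridgePotential N L (fun l => K l j) (i + 1) ≠ 0 by
      have := lt_of_le_of_ne h2 this.symm
      linarith
    intro h0
    -- A zero of the potential next to the boundary propagates up to `j`, where the slope jumps.
    have hzero : ∀ l : ℕ, l + 1 ≤ m → bridgePotential N L (fun l => K l j) l = 0 ∧
        bridgePotential N L (fun l => K l j) (l + 1) = 0 := by
      intro l
      induction l with
      | zero => exact fun _ => ⟨bridgePotential_zero hL0 _, by rw [← hi]; exact h0⟩
      | succ l ih =>
        intro hl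
        obtain ⟨ih1, ih2⟩ := ih (by omega)
        refine ⟨ih2, ?_⟩
        have h3 := hcol ⟨l, by omega⟩ j
        rw [if_neg (fun h => by rw [Fin.ext_iff] at h; simp only at h; omega)] at h3
        have h4 := bridgePotential_second_difference hN L (fun l => K l j) ⟨l, by omega⟩
        simp only at h3 h4
        rw [ih2, add_zero] at h3
        rw [ih1, ih2, h3] at h4
        have h5 := (sub_pos.2 (hL l (by omega))).ne'
        have h6 : (L (l + 1) - L l) * (0 - bridgePotential N L (fun l => K l j) (l + 2)) = 0 := by
          linarith
        rcases mul_eq_zero.1 h6 with h7 | h7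
        · exact absurd h7 h5
        · linarith
    obtain ⟨h3, h4⟩ := hzero j (by omega)
    have h5 := hcol j j
    have h6 := bridgePotential_second_difference hN L (fun l => K l j) j
    have h7 : bridgePotential N L (fun l => K l j) (j + 2) = 0 := by
      rw [show (j : ℕ) + 2 = m + 1 by omega]
      exact bridgePotential_last hLm _
    rw [h4, if_pos rfl, add_zero] at h5
    rw [h3, h4, h7, h5] at h6
    have h8 := mul_pos (sub_pos.2 (hL j (by omega))) (sub_pos.2 (hL (j + 1) (by omega)))
    rw [show (j : ℕ) + 1 + 1 = j + 2 by rfl] at h8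
    linarith

/-! ### The subdivided ladder as a cycle with chords -/

theorem natCast_zmod_inj_of_lt {N x y : ℕ} (hx : x < N) (hy : y < N) :
    (x : ZMod N) = y ↔ x = y := by
  rw [ZMod.natCast_eq_natCast_iff', Nat.mod_eq_of_lt hx, Nat.mod_eq_of_lt hy]

theorem natCast_zmod_ne_zero_of_lt {N x : ℕ} (h0 : 0 < x) (hx : x < N) : (x : ZMod N) ≠ 0 := by
  rw [Ne, ZMod.natCast_eq_zero_iff]
  exact Nat.not_dvd_of_pos_of_lt h0 hx

/-- The numbering of the vertices of the subdivided ladder along its outer cycle: the top path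
backwards, then the bottom path. -/
def ladderPos {n : ℕ} (a b : Fin n → ℕ) (N : ℕ) : LadderVertex a b → ZMod N
  | .inl x => -((x : ℕ) : ZMod N)
  | .inr y => ((y : ℕ) : ZMod N) + 1

theorem ladder_top_eq_top_iff {N x y : ℕ} (hx : x < N) (hy : y < N) :
    (-(x : ZMod N)) = -(y : ZMod N) ↔ x = y := by
  rw [neg_inj, natCast_zmod_inj_of_lt hx hy]

theorem ladder_bot_eq_bot_iff {N x y : ℕ} (hx : x < N) (hy : y < N) :
    (x : ZMod N) + 1 = (y : ZMod N) + 1 ↔ x = y := by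
  rw [add_left_inj, natCast_zmod_inj_of_lt hx hy]

theorem ladder_top_ne_bot {N x y : ℕ} (h : x + y + 2 ≤ N) :
    (-(x : ZMod N)) ≠ (y : ZMod N) + 1 := by
  intro he
  refine natCast_zmod_ne_zero_of_lt (show 0 < x + y + 1 by omega) (show x + y + 1 < N by omega) ?_
  push_cast
  linear_combination -he

theorem ladder_top_eq_top_add_one_iff {N x y : ℕ} (hx : x < N) (hy : y + 1 < N) :
    (-(y : ZMod N)) = -(x : ZMod N) + 1 ↔ y + 1 = x := by
  rw [← natCast_zmod_inj_of_lt hy hx]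
  push_cast
  constructor <;> intro h
  · linear_combination -h
  · linear_combination -h

theorem ladder_bot_eq_bot_add_one_iff {N x y : ℕ} (hx : x + 1 < N) (hy : y < N) :
    (y : ZMod N) + 1 = (x : ZMod N) + 1 + 1 ↔ x + 1 = y := by
  rw [← natCast_zmod_inj_of_lt hx hy]
  push_cast
  rw [add_left_inj, eq_comm]

theorem ladder_bot_eq_top_add_one_iff {N x y : ℕ} (h : x + y + 2 ≤ N) :
    (y : ZMod N) + 1 = -(x : ZMod N) + 1 ↔ x = 0 ∧ y = 0 := by
  rw [add_left_inj]
  constructor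
  · intro he
    by_contra hne
    refine natCast_zmod_ne_zero_of_lt (show 0 < x + y by omega) (show x + y < N by omega) ?_
    push_cast
    linear_combination he
  · rintro ⟨rfl, rfl⟩
    simp

theorem ladder_top_eq_bot_add_one_iff {N x y : ℕ} (h : x + y + 2 ≤ N) :
    (-(x : ZMod N)) = (y : ZMod N) + 1 + 1 ↔ x + y + 2 = N := by
  constructor
  · intro he
    by_contra hne
    refine natCast_zmod_ne_zero_of_lt (show 0 < x + y + 2 by omega)
      (show x + y + 2 < N by omega) ?_
    push_cast
    linear_combination -he
  · intro he
    have : ((x + y + 2 : ℕ) : ZMod N) = 0 := by rw [he, ZMod.natCast_self]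
    push_cast at this
    linear_combination -this

theorem ladderPos_bijective {n : ℕ} {a b : Fin n → ℕ} {N : ℕ}
    (hN : rungPos a n + rungPos b n + 2 = N) : Function.Bijective (ladderPos a b N) := by
  have : NeZero N := ⟨by omega⟩
  rw [Fintype.bijective_iff_injective_and_card]
  refine ⟨?_, ?_⟩
  · rintro (x | x) (y | y) h <;> have hx := x.isLt <;> have hy := y.isLt <;>
      simp only [ladderPos] at h
    · rw [ladder_top_eq_top_iff (by omega) (by omega)] at h
      rw [Fin.ext h]
    · exact absurd h (ladder_top_ne_bot (by omega))
    · exact absurd h.symm (ladder_top_ne_bot (by omega))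
    · rw [ladder_bot_eq_bot_iff (by omega) (by omega)] at h
      rw [Fin.ext h]
  · rw [Fintype.card_sum, Fintype.card_fin, Fintype.card_fin, ZMod.card]
    omega

/-- The top end of the `j`-th inner rung on the outer cycle. -/
def rungTop {m : ℕ} (a : Fin (m + 1) → ℕ) (N : ℕ) (j : Fin m) : ZMod N :=
  -(rungPos a ((j : ℕ) + 1) : ZMod N)

/-- The bottom end of the `j`-th inner rung on the outer cycle. -/
def rungBot {m : ℕ} (b : Fin (m + 1) → ℕ) (N : ℕ) (j : Fin m) : ZMod N :=
  (rungPos b ((j : ℕ) + 1) : ZMod N) + 1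

theorem isChordFamily_rung {m : ℕ} {a b : Fin (m + 1) → ℕ} {N : ℕ}
    (hN : rungPos a (m + 1) + rungPos b (m + 1) + 2 = N) :
    IsChordFamily N (rungTop a N) (rungBot b N) := by
  have ha : ∀ j : Fin m, 0 < rungPos a ((j : ℕ) + 1) ∧
      rungPos a ((j : ℕ) + 1) < rungPos a (m + 1) := fun j =>
    ⟨by have := rungPos_lt a (show 0 < (j : ℕ) + 1 by omega) (by omega); omega,
      rungPos_lt a (by omega) le_rfl⟩
  have hb : ∀ j : Fin m, 0 < rungPos b ((j : ℕ) + 1) ∧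
      rungPos b ((j : ℕ) + 1) < rungPos b (m + 1) := fun j =>
    ⟨by have := rungPos_lt b (show 0 < (j : ℕ) + 1 by omega) (by omega); omega,
      rungPos_lt b (by omega) le_rfl⟩
  refine ⟨?_, ?_, ?_, ?_, ?_⟩
  · intro i j h
    have hi := ha i
    have hj := ha j
    rw [rungTop, rungTop, ladder_top_eq_top_iff (by omega) (by omega)] at h
    have := rungPos_inj a (by omega) (by omega) h
    exact Fin.ext (by omega)
  · intro i j h
    have hi := hb i
    have hj := hb j
    rw [rungBot, rungBot, ladder_bot_eq_bot_iff (by omega) (by omega)] at h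
    have := rungPos_inj b (by omega) (by omega) h
    exact Fin.ext (by omega)
  · intro i j
    have hi := ha i
    have hj := hb j
    exact ladder_top_ne_bot (by omega)
  · intro j h
    have h1 := ha j
    have h2 := hb j
    rw [rungTop, rungBot, ladder_bot_eq_top_add_one_iff (by omega)] at h
    omega
  · intro j h
    have h1 := ha j
    have h2 := hb j
    rw [rungTop, rungBot, ladder_top_eq_bot_add_one_iff (by omega)] at h
    omega

theorem adj_chordedCycle_ladderPos_iff {m : ℕ} {a b : Fin (m + 1) → ℕ} {N : ℕ}
    (hN : rungPos a (m + 1) + rungPos b (m + 1) + 2 = N) (v w : LadderVertex a b) :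
    (chordedCycle N (rungTop a N) (rungBot b N)).Adj (ladderPos a b N v) (ladderPos a b N w) ↔
      (subdividedLadder a b).Adj v w := by
  have ha : ∀ j : Fin m, rungPos a ((j : ℕ) + 1) ≤ rungPos a (m + 1) := fun j =>
    rungPos_mono a (by omega)
  have hb : ∀ j : Fin m, rungPos b ((j : ℕ) + 1) ≤ rungPos b (m + 1) := fun j =>
    rungPos_mono b (by omega)
  have hne : ∀ v w : LadderVertex a b, (ladderPos a b N v ≠ ladderPos a b N w) ↔ v ≠ w :=
    fun v w => (ladderPos_bijective hN).injective.ne_iff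
  have htb : ∀ (x : Fin (rungPos a (m + 1) + 1)) (y : Fin (rungPos b (m + 1) + 1)),
      (chordedCycle N (rungTop a N) (rungBot b N)).Adj (ladderPos a b N (Sum.inl x))
        (ladderPos a b N (Sum.inr y)) ↔ (subdividedLadder a b).Adj (Sum.inl x) (Sum.inr y) := by
    intro x y
    have hx := x.isLt
    have hy := y.isLt
    rw [subdividedLadder_adj_inl_inr]
    simp only [chordedCycle, ladderPos, rungTop, rungBot]
    rw [ladder_bot_eq_top_add_one_iff (by omega), ladder_top_eq_bot_add_one_iff (by omega)]
    constructor
    · rintro ⟨-, h | h | ⟨j, h | h⟩⟩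
      · exact ⟨0, by omega, by rw [rungPos_zero]; exact h.1, by rw [rungPos_zero]; exact h.2⟩
      · exact ⟨m + 1, le_rfl, by omega, by omega⟩
      · have haj := ha j
        have hbj := hb j
        rw [ladder_top_eq_top_iff (by omega) (by omega),
          ladder_bot_eq_bot_iff (by omega) (by omega)] at h
        exact ⟨j + 1, by omega, h⟩
      · have hbj := hb j
        exact absurd h.1 (ladder_top_ne_bot (by omega))
    · rintro ⟨j, hj, h1, h2⟩
      refine ⟨ladder_top_ne_bot (by omega), ?_⟩
      rcases Nat.eq_zero_or_pos j with rfl | hj0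
      · rw [rungPos_zero] at h1 h2
        exact Or.inl ⟨h1, h2⟩
      rcases hj.lt_or_eq with hjm | rfl
      · refine Or.inr (Or.inr ⟨⟨j - 1, by omega⟩, Or.inl ?_⟩)
        rw [h1, h2]
        simp only [Nat.sub_add_cancel hj0, and_self]
      · exact Or.inr (Or.inl (by omega))
  rcases v with x | x <;> rcases w with y | y
  · have hx := x.isLt
    have hy := y.isLt
    rw [subdividedLadder_adj_inl_inl]
    simp only [chordedCycle, ladderPos, rungTop, rungBot]
    rw [Ne, ladder_top_eq_top_iff (by omega) (by omega),
      ladder_top_eq_top_add_one_iff (by omega) (by omega),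
      ladder_top_eq_top_add_one_iff (by omega) (by omega)]
    constructor
    · rintro ⟨-, h | h | ⟨j, h | h⟩⟩
      · exact Or.inr h
      · exact Or.inl h
      · have hbj := hb j
        exact absurd h.2 (ladder_top_ne_bot (by omega))
      · have hbj := hb j
        exact absurd h.1 (ladder_top_ne_bot (by omega))
    · intro h
      exact ⟨by omega, by omega⟩
  · exact htb x y
  · rw [SimpleGraph.adj_comm, htb, SimpleGraph.adj_comm]
  · have hx := x.isLt
    have hy := y.isLt
    rw [subdividedLadder_adj_inr_inr]
    simp only [chordedCycle, ladderPos, rungTop, rungBot]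
    rw [Ne, ladder_bot_eq_bot_iff (by omega) (by omega),
      ladder_bot_eq_bot_add_one_iff (by omega) (by omega),
      ladder_bot_eq_bot_add_one_iff (by omega) (by omega)]
    constructor
    · rintro ⟨-, h | h | ⟨j, h | h⟩⟩
      · exact Or.inl h
      · exact Or.inr h
      · have haj := ha j
        exact absurd h.1.symm (ladder_top_ne_bot (by omega))
      · have haj := ha j
        exact absurd h.2.symm (ladder_top_ne_bot (by omega))
    · intro h
      exact ⟨by omega, by omega⟩

/-- The subdivided ladder is its outer cycle together with the inner rungs as chords. -/
noncomputable def ladderIso {m : ℕ} {a b : Fin (m + 1) → ℕ} {N : ℕ}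
    (hN : rungPos a (m + 1) + rungPos b (m + 1) + 2 = N) :
    subdividedLadder a b ≃g chordedCycle N (rungTop a N) (rungBot b N) where
  toEquiv := Equiv.ofBijective _ (ladderPos_bijective hN)
  map_rel_iff' := adj_chordedCycle_ladderPos_iff hN _ _

/-! ### The Kirchhoff index of the subdivided ladder -/

theorem rungPos_add_rungPos {n : ℕ} {k a b : Fin n → ℕ} (hab : ∀ i, a i + b i + 4 = k i) (j : ℕ) :
    rungPos a j + rungPos b j = rungPos (fun i => k i - 3) j := by
  unfold rungPos
  rw [← Finset.sum_add_distrib]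
  refine Finset.sum_congr rfl fun i _ => ?_
  have := hab i
  dsimp only
  omega

/-- The number of outer edges on one side of the `j`-th rung, with the conventions `0` and `N`
at the two ends of the ladder. -/
noncomputable def rungLevel {m : ℕ} (k : Fin (m + 1) → ℕ) (j : ℕ) : ℝ :=
  if j = 0 then 0
  else if j = m + 1 then (rungPos (fun i => k i - 3) (m + 1) + 2 : ℕ)
  else (rungPos (fun i => k i - 3) j + 1 : ℕ)

theorem rungLevel_lt {m : ℕ} (k : Fin (m + 1) → ℕ) (i : ℕ) (hi : i ≤ m) :
    rungLevel k i < rungLevel k (i + 1) := by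
  have h := rungPos_lt (fun i => k i - 3) (show i < i + 1 by omega) (by omega)
  unfold rungLevel
  rw [if_neg (Nat.succ_ne_zero i), if_neg (show i ≠ m + 1 by omega)]
  split_ifs with h1 h2 h2
  · exact_mod_cast Nat.succ_pos _
  · exact_mod_cast Nat.succ_pos _
  · obtain rfl : i = m := by omega
    rw [Nat.cast_lt]
    omega
  · rw [Nat.cast_lt]
    omega

theorem rungLevel_inner {m : ℕ} {k a b : Fin (m + 1) → ℕ} (hab : ∀ i, a i + b i + 4 = k i)
    (j : Fin m) : rungLevel k ((j : ℕ) + 1) =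
      (rungPos a ((j : ℕ) + 1) : ℝ) + rungPos b ((j : ℕ) + 1) + 1 := by
  rw [rungLevel, if_neg (Nat.succ_ne_zero _), if_neg (by omega), ← rungPos_add_rungPos hab]
  push_cast
  ring

/-- Twice the displacement of the centre of the part of the outer cycle that is cut off by the
`j`-th rung. -/
def rungShift {n : ℕ} (a b : Fin n → ℕ) (j : ℕ) : ℝ := (rungPos b j : ℝ) - rungPos a j

theorem chordPairing_comm {N : ℕ} {F : ZMod N → ℝ} (hF : ∀ d, F (-d) = F d) (p q p' q' : ZMod N) :
    chordPairing F p q p' q' = chordPairing F p' q' p q := by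
  simp only [chordPairing, dipole]
  rw [← hF (q' - q), ← hF (q' - p), ← hF (p' - q), ← hF (p' - p)]
  simp only [neg_sub]
  ring

theorem chordPairing_cycleGreen_rung {m : ℕ} {k a b : Fin (m + 1) → ℕ}
    (hab : ∀ i, a i + b i + 4 = k i) {N : ℕ}
    (hN : rungPos a (m + 1) + rungPos b (m + 1) + 2 = N) (i j : Fin m) :
    chordPairing cycleGreen (rungTop a N i) (rungBot b N i) (rungTop a N j) (rungBot b N j) =
      bridgeKernel N (rungLevel k) ((i : ℕ) + 1) ((j : ℕ) + 1) := by
  have : NeZero N := ⟨by omega⟩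
  wlog hij : i ≤ j generalizing i j
  · rw [chordPairing_comm cycleGreen_neg, this _ _ (le_of_not_ge hij), bridgeKernel_comm]
  have hij' : (i : ℕ) + 1 ≤ j + 1 := Nat.succ_le_succ hij
  obtain ⟨v, hv⟩ := Nat.exists_eq_add_of_le (rungPos_mono a hij')
  obtain ⟨u, hu⟩ := Nat.exists_eq_add_of_le (rungPos_mono b hij')
  have ha := rungPos_mono a (show (j : ℕ) + 1 ≤ m + 1 by omega)
  have hb := rungPos_mono b (show (j : ℕ) + 1 ≤ m + 1 by omega)
  rw [bridgeKernel, min_eq_left hij', max_eq_right hij', rungLevel_inner hab, rungLevel_inner hab,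
    rungTop, rungTop, rungBot, rungBot, hv, hu, chordPairing_cycleGreen_nested (by omega)]
  push_cast
  ring

/-- The part of the interaction of two rungs that only depends on the sizes of the polygons. -/
noncomputable def rungPairingBase (N : ℝ) (L : ℕ → ℝ) (i j : ℕ) : ℝ :=
  bridgeKernel N L i j * (2 * N * L (max i j) - (L (max i j) - L (min i j)) ^ 2 -
    2 * L (min i j) * L (max i j) + 4) / 24

theorem chordPairing_cycleBigreen_rung {m : ℕ} {k a b : Fin (m + 1) → ℕ}
    (hab : ∀ i, a i + b i + 4 = k i) {N : ℕ}
    (hN : rungPos a (m + 1) + rungPos b (m + 1) + 2 = N) (i j : Fin m) :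
    chordPairing cycleBigreen (rungTop a N i) (rungBot b N i) (rungTop a N j) (rungBot b N j) =
      rungPairingBase N (rungLevel k) ((i : ℕ) + 1) ((j : ℕ) + 1) -
        bridgeKernel N (rungLevel k) ((i : ℕ) + 1) ((j : ℕ) + 1) / 8 *
          (rungShift a b ((i : ℕ) + 1) - rungShift a b ((j : ℕ) + 1)) ^ 2 := by
  have : NeZero N := ⟨by omega⟩
  wlog hij : i ≤ j generalizing i j
  · rw [chordPairing_comm cycleBigreen_neg, this _ _ (le_of_not_ge hij), bridgeKernel_comm,
      rungPairingBase, rungPairingBase, bridgeKernel_comm, max_comm, min_comm]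
    ring
  have hij' : (i : ℕ) + 1 ≤ j + 1 := Nat.succ_le_succ hij
  obtain ⟨v, hv⟩ := Nat.exists_eq_add_of_le (rungPos_mono a hij')
  obtain ⟨u, hu⟩ := Nat.exists_eq_add_of_le (rungPos_mono b hij')
  have ha := rungPos_mono a (show (j : ℕ) + 1 ≤ m + 1 by omega)
  have hb := rungPos_mono b (show (j : ℕ) + 1 ≤ m + 1 by omega)
  rw [rungPairingBase, bridgeKernel, min_eq_left hij', max_eq_right hij', rungLevel_inner hab,
    rungLevel_inner hab, rungTop, rungTop, rungBot, rungBot, rungShift, rungShift, hv, hu,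
    chordPairing_cycleBigreen_nested (by omega)]
  push_cast
  ring

/-- The Kirchhoff index of a polygonal chain is a constant minus a positive combination of the
squares of the relative displacements of its rungs. -/
theorem exists_kirchhoffIndex_subdividedLadder {m : ℕ} (k : Fin (m + 1) → ℕ) :
    ∃ (C : ℝ) (c : Fin m → Fin m → ℝ), (∀ i j : Fin m, i ≠ j → 0 ≤ c i j) ∧
      (∀ i j : Fin m, i ≠ j → (i : ℕ) = 0 → (j : ℕ) + 1 = m → 0 < c i j) ∧
      ∀ a b : Fin (m + 1) → ℕ, (∀ i, a i + b i + 4 = k i) →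
        kirchhoffIndex (subdividedLadder a b) =
          C - ∑ i, ∑ j, c i j *
            (rungShift a b ((i : ℕ) + 1) - rungShift a b ((j : ℕ) + 1)) ^ 2 := by
  obtain ⟨N, hN⟩ : ∃ N, N = rungPos (fun i => k i - 3) (m + 1) + 2 := ⟨_, rfl⟩
  have hN3 : 3 ≤ N := by
    have := rungPos_lt (fun i => k i - 3) (show 0 < m + 1 by omega) le_rfl
    omega
  have : NeZero N := ⟨by omega⟩
  have hNpos : (0 : ℝ) < N := by exact_mod_cast (by omega : 0 < N)
  have hL0 : rungLevel k 0 = 0 := if_pos rfl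
  have hLm : rungLevel k (m + 1) = N := by
    rw [rungLevel, if_neg (Nat.succ_ne_zero m), if_pos rfl, hN]
  obtain ⟨K, hK, hK1, hK2⟩ :=
    exists_inverse_one_add_bridgeKernel hNpos.ne' hL0 hLm (rungLevel_lt k)
  have hlevel : ∀ i j : ℕ, i < j → j ≤ m + 1 → rungLevel k i < rungLevel k j := by
    intro i j hij
    induction j, hij using Nat.le_induction with
    | base => exact fun h => rungLevel_lt k i (by omega)
    | succ j hij ih => exact fun h => (ih (by omega)).trans (rungLevel_lt k j (by omega))
  have hker : ∀ i j : Fin m, 0 < bridgeKernel N (rungLevel k) ((i : ℕ) + 1) ((j : ℕ) + 1) := by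
    intro i j
    have h1 := hlevel 0 (min ((i : ℕ) + 1) (j + 1)) (by omega) (by omega)
    have h2 := hlevel (max ((i : ℕ) + 1) (j + 1)) (m + 1) (by omega) le_rfl
    rw [hL0] at h1
    rw [hLm] at h2
    exact div_pos (mul_pos h1 (sub_pos.2 h2)) hNpos
  refine ⟨(N * ∑ u : ZMod N, cycleGreen (u - u) - ∑ u : ZMod N, ∑ v : ZMod N, cycleGreen (v - u)) -
      N * ∑ i, ∑ j, K i j * rungPairingBase N (rungLevel k) ((i : ℕ) + 1) ((j : ℕ) + 1),
    fun i j => N * -K i j * (bridgeKernel N (rungLevel k) ((i : ℕ) + 1) ((j : ℕ) + 1) / 8),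
    ?_, ?_, ?_⟩
  · intro i j hij
    have h1 := hK1 i j hij
    have h2 := hker i j
    exact mul_nonneg (mul_nonneg hNpos.le (by linarith)) (by linarith)
  · intro i j hij hi hj
    have h1 := hK2 i j hij hi hj
    have h2 := hker i j
    exact mul_pos (mul_pos hNpos (by linarith)) (by linarith)
  · intro a b hab
    have hNab : rungPos a (m + 1) + rungPos b (m + 1) + 2 = N := by
      rw [rungPos_add_rungPos hab, hN]
    rw [kirchhoffIndex_iso (ladderIso hNab),
      kirchhoffIndex_chordedCycle hN3 (isChordFamily_rung hNab) K
        (by simpa only [chordPairing_cycleGreen_rung hab hNab] using hK)]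
    simp only [chordPairing_cycleBigreen_rung hab hNab, mul_sub, Finset.sum_sub_distrib]
    have hc : ∑ i : Fin m, ∑ j : Fin m, (N : ℝ) * -K i j *
        (bridgeKernel N (rungLevel k) ((i : ℕ) + 1) ((j : ℕ) + 1) / 8) *
          (rungShift a b ((i : ℕ) + 1) - rungShift a b ((j : ℕ) + 1)) ^ 2 =
        -((N : ℝ) * ∑ i : Fin m, ∑ j : Fin m, K i j *
          (bridgeKernel N (rungLevel k) ((i : ℕ) + 1) ((j : ℕ) + 1) / 8 *
            (rungShift a b ((i : ℕ) + 1) - rungShift a b ((j : ℕ) + 1)) ^ 2)) := by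
      simp only [Finset.mul_sum, ← Finset.sum_neg_distrib]
      exact Finset.sum_congr rfl fun i _ => Finset.sum_congr rfl fun j _ => by ring
    rw [hc]
    ring

/-! ### The minimum -/

/-- The number of vertices added between the rungs `i` and `j`, on the side described by `a`. -/
def addedBetween {n : ℕ} (a : Fin n → ℕ) (i j : ℕ) : ℕ :=
  ∑ l ∈ Finset.univ.filter (fun l : Fin n => i ≤ (l : ℕ) ∧ (l : ℕ) < j), a l

theorem rungPos_eq_add_addedBetween {n : ℕ} (a : Fin n → ℕ) {i j : ℕ} (hij : i ≤ j) (hj : j ≤ n) :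
    rungPos a j = rungPos a i + (addedBetween a i j + (j - i)) := by
  induction j, hij using Nat.le_induction with
  | base =>
    have : addedBetween a i i = 0 :=
      Finset.sum_eq_zero fun l hl => by
        rw [Finset.mem_filter] at hl
        omega
    omega
  | succ j hij ih =>
    have h1 := rungPos_succ a ⟨j, hj⟩
    have h2 : addedBetween a i (j + 1) = addedBetween a i j + a ⟨j, hj⟩ := by
      have : Finset.univ.filter (fun l : Fin n => i ≤ (l : ℕ) ∧ (l : ℕ) < j + 1) =
          insert ⟨j, hj⟩ (Finset.univ.filter (fun l : Fin n => i ≤ (l : ℕ) ∧ (l : ℕ) < j)) := by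
        ext l
        simp only [Finset.mem_filter, Finset.mem_univ, true_and, Finset.mem_insert, Fin.ext_iff]
        omega
      rw [addedBetween, this, Finset.sum_insert (by simp), add_comm]
      rfl
    have h3 := ih (by omega)
    simp only at h1
    omega

theorem sq_rungShift_sub_of_le {n : ℕ} (a b : Fin n → ℕ) {i j : ℕ} (hij : i ≤ j) (hj : j ≤ n) :
    (rungShift (fun _ => 0) (fun l => a l + b l) i -
        rungShift (fun _ => 0) (fun l => a l + b l) j) ^ 2 =
      (rungShift a b i - rungShift a b j) ^ 2 + 4 * (addedBetween a i j * addedBetween b i j) := by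
  have h0 : addedBetween (fun _ : Fin n => 0) i j = 0 := Finset.sum_const_zero
  have h1 : addedBetween (fun l => a l + b l) i j = addedBetween a i j + addedBetween b i j :=
    Finset.sum_add_distrib
  simp only [rungShift, rungPos_eq_add_addedBetween _ hij hj, h0, h1]
  push_cast
  ring

/-- The helicene maximizes the relative displacement of any two rungs. -/
theorem sq_rungShift_sub_le {n : ℕ} (a b : Fin n → ℕ) {i j : ℕ} (hi : i ≤ n) (hj : j ≤ n) :
    (rungShift a b i - rungShift a b j) ^ 2 ≤
      (rungShift (fun _ => 0) (fun l => a l + b l) i -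
        rungShift (fun _ => 0) (fun l => a l + b l) j) ^ 2 := by
  wlog hij : i ≤ j generalizing i j
  · rw [← neg_sub (rungShift a b j), neg_sq,
      ← neg_sub (rungShift (fun _ => 0) (fun l => a l + b l) j), neg_sq]
    exact this hj hi (le_of_not_ge hij)
  rw [sq_rungShift_sub_of_le a b hij hj]
  have : (0 : ℝ) ≤ addedBetween a i j * addedBetween b i j := by positivity
  linarith

theorem addedBetween_eq_zero_iff {n : ℕ} (a : Fin n → ℕ) (i j : ℕ) :
    addedBetween a i j = 0 ↔ ∀ l : Fin n, i ≤ (l : ℕ) → (l : ℕ) < j → a l = 0 := by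
  simp only [addedBetween, Finset.sum_eq_zero_iff, Finset.mem_filter, Finset.mem_univ, true_and,
    and_imp]

/-- Among all subdivided ladders with given polygon sizes, the Kirchhoff index is minimal if all
added vertices are at the bottom; if it is minimal, then the inner polygons have all their added
vertices on the same side. -/
theorem kirchhoffIndex_subdividedLadder_min {m : ℕ} (a b : Fin (m + 1) → ℕ) :
    kirchhoffIndex (subdividedLadder (fun _ => 0) (fun i => a i + b i)) ≤
        kirchhoffIndex (subdividedLadder a b) ∧
      (kirchhoffIndex (subdividedLadder a b) =
          kirchhoffIndex (subdividedLadder (fun _ => 0) (fun i => a i + b i)) →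
        (∀ i : Fin (m + 1), 0 < (i : ℕ) → (i : ℕ) + 1 < m + 1 → a i = 0) ∨
        (∀ i : Fin (m + 1), 0 < (i : ℕ) → (i : ℕ) + 1 < m + 1 → b i = 0)) := by
  obtain ⟨C, c, hc1, hc2, hC⟩ := exists_kirchhoffIndex_subdividedLadder fun i => a i + b i + 4
  rw [hC a b fun _ => rfl, hC (fun _ => 0) (fun i => a i + b i) fun _ => by omega]
  have hle : ∀ i j : Fin m,
      c i j * (rungShift a b ((i : ℕ) + 1) - rungShift a b ((j : ℕ) + 1)) ^ 2 ≤
      c i j * (rungShift (fun _ => 0) (fun l => a l + b l) ((i : ℕ) + 1) -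
        rungShift (fun _ => 0) (fun l => a l + b l) ((j : ℕ) + 1)) ^ 2 := by
    intro i j
    by_cases hij : i = j
    · subst hij
      simp
    · exact mul_le_mul_of_nonneg_left (sq_rungShift_sub_le a b (by omega) (by omega))
        (hc1 i j hij)
  constructor
  · exact sub_le_sub_left (Finset.sum_le_sum fun i _ => Finset.sum_le_sum fun j _ => hle i j) C
  · intro heq
    rcases Nat.lt_or_ge m 2 with hm | hm
    · exact Or.inl fun i h1 h2 => by omega
    have hsum := sub_right_injective heq
    rw [Finset.sum_eq_sum_iff_of_le fun i _ => Finset.sum_le_sum fun j _ => hle i j] at hsum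
    have h1 := hsum ⟨0, by omega⟩ (Finset.mem_univ _)
    rw [Finset.sum_eq_sum_iff_of_le fun j _ => hle _ j] at h1
    have h2 := h1 ⟨m - 1, by omega⟩ (Finset.mem_univ _)
    have h3 := hc2 ⟨0, by omega⟩ ⟨m - 1, by omega⟩
      (by rw [Ne, Fin.ext_iff]; simp only; omega) rfl (by simp only; omega)
    have h4 := mul_left_cancel₀ h3.ne' h2
    rw [sq_rungShift_sub_of_le a b (by simp only; omega) (by simp only; omega)] at h4
    have h5 : ((addedBetween a (0 + 1) (m - 1 + 1) * addedBetween b (0 + 1) (m - 1 + 1) : ℕ) : ℝ)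
        = 0 := by
      push_cast
      linarith
    rw [Nat.cast_eq_zero, mul_eq_zero, addedBetween_eq_zero_iff, addedBetween_eq_zero_iff] at h5
    rcases h5 with h5 | h5
    · exact Or.inl fun i hi1 hi2 => h5 i (by omega) (by omega)
    · exact Or.inr fun i hi1 hi2 => h5 i (by omega) (by omega)

theorem theorem2 (n : ℕ) (hn : 1 ≤ n) (k : Fin n → ℕ) (hk : ∀ i, 4 ≤ k i) :
    IsPolygonalChain k (helicene k) ∧
    ∀ (V : Type*) [Fintype V] (G : SimpleGraph V), IsPolygonalChain k G →
      kirchhoffIndex (helicene k) ≤ kirchhoffIndex G ∧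
      (kirchhoffIndex G = kirchhoffIndex (helicene k) ↔ Nonempty (G ≃g helicene k)) := by
  obtain ⟨m, rfl⟩ : ∃ m, n = m + 1 := ⟨n - 1, by omega⟩
  have hk0 : ∀ i, 0 + 4 ≤ k i := fun i => by simpa using hk i
  have hhel : IsChainParam k (fun _ => 0) (helicene k)
      (ladderPolygon fun i => by
        show 0 + (k i - 4 - 0) + 4 = k i
        have := hk i
        omega) := isChainParam_ladderPolygon hn _
  refine ⟨hhel.isPolygonalChain hk0, ?_⟩
  intro V _ G hG
  obtain ⟨a, e, ha, he⟩ := hG.exists_isChainParam hk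
  have hab : ∀ i, a i + (k i - 4 - a i) + 4 = k i := fun i => by have := ha i; omega
  obtain ⟨f⟩ := he.nonempty_iso (isChainParam_ladderPolygon hn hab)
  have hsum : (fun i => a i + (k i - 4 - a i)) = fun i => k i - 4 - 0 := by
    funext i
    have := ha i
    omega
  have hmin := kirchhoffIndex_subdividedLadder_min a fun i => k i - 4 - a i
  rw [hsum, ← kirchhoffIndex_iso f] at hmin
  refine ⟨hmin.1, fun h => ?_, fun ⟨g⟩ => kirchhoffIndex_iso g⟩
  rcases hmin.2 h with h0 | h0
  · obtain ⟨e', he'⟩ := he.change_ends ha hk0 h0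
    exact he'.nonempty_iso hhel
  · obtain ⟨e', he'⟩ := he.flip ha
    obtain ⟨e'', he''⟩ := he'.change_ends (fun i => by have := ha i; omega) hk0 h0
    exact he''.nonempty_iso hhel
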